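/- **Setting.** Let $\mathbb F\in\{\mathbb R,\mathbb C\}$, let $M$ be a Hausdorff smooth manifold and $R=C_c^\infty(M)$ the algebra of $\mathbb F$-valued smooth functions with compact support. A *Hopf algebroid* over $R$ is an associative $\mathbb F$-algebra $A$, perhaps without identity, which contains $R$ as a subalgebra and has local identities in $R$ (for $a_1,\dots,a_k\in A$ there is $r\in R$ with $ra_i=a_ir=a_i$ for all $i$), together with $\mathbb F$-linear maps $\Delta:A\to A\otimes_R^{ll}A$ (tensor product over the left $R$-actions), $\epsilon:A\to R$, $S:A\to A$ such that: $\Delta,\epsilon$ are left $R$-linear with $(\mathrm{id}\otimes\epsilon)\Delta=\mathrm{id}=(\epsilon\otimes\mathrm{id})\Delta$; $\epsilon|_R=\mathrm{id}$, $\Delta|_R$ is the canonical embedding $R\cong R\otimes_RR\subset A\otimes_R^{ll}A$, and the two right $R$-actions on $A\otimes^{ll}_RA$ coincide on $\Delta A$; $\Delta(ab)=\Delta(a)\Delta(b)$; $S|_R=\mathrm{id}$, $S^2=\mathrm{id}$, $S(ab)=S(b)S(a)$; and $\mu\circ(S\otimes\mathrm{id})\circ\Delta=\epsilon\circ S$,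 where $\mu$ is the multiplication. A homomorphism of Hopf algebroids over $R$ is an algebra homomorphism which is the identity on $R$ and commutes with $\Delta,\epsilon,S$. For $x\in M$ let $A_x=A/N_x(A)$, where $N_x(A)$ is the set of $a\in A$ with $fa=0$ for some $f\in R$ equal to $1$ near $x$, and let $a_x$ be the class of $a$. Then $A_x$ is a coalgebra, with the induced maps $\Delta_x,\epsilon_x$, over the ring $R_x$ of germs at $x$; let $G(A_x)=\{\zeta\in A_x:\Delta_x\zeta=\zeta\otimes\zeta,\ \epsilon_x\zeta=1\}$. An element $a\in A$ is *normalized at* $x$ if $\epsilon(a)=1$ near $x$, and normalized on $W\subset M$ if it is normalized at each point of $W$; it is *weakly grouplike* if $\Delta(a)=a\otimes a'$ for some $a'\in A$, and *$S$-invariant weakly grouplike* ($a\in G^S_w(A)$) if for some $a'\in A$ both $\Delta(a)=a\otimes a'$ and $\Delta(S(a))=S(a')\otimes S(a)$. The *spectral sheaf* $\mathcal E_{sp}(A)$ over $M$ has stalks $G(A_x)$ and the topology generated by the sets $c_W=\{c_x: x\in W\}$, for $W\subset M$ open and $c$ weakly grouplike and normalized on $W$; a homomorphism $\alpha$ induces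 $\mathcal E_{sp}(\alpha)$, $c_x\mapsto\alpha(c)_x$. Let $\mathcal G_{sp}(A)\subset\mathcal E_{sp}(A)$ be the subspace of *arrows*, i.e. of the elements $a_y\in G(A_y)$ with $a\in G^S_w(A)$ normalized at $y$. For $a\in G^S_w(A)$ put $T_a(f)=\epsilon(S(fa))$, $f\in R$. An *étale Lie groupoid* over $M$ is a groupoid with objects $M$ whose space of arrows is a (not necessarily Hausdorff) smooth manifold and whose source, target, unit, inverse and multiplication maps are local diffeomorphisms. A morphism of étale Lie groupoids over $M$ is a smooth map which preserves source, target, units and multiplication. **Theorem.** Let $A$ be a Hopf algebroid over $C_c^\infty(M)$. 1. If $a\in G^S_w(A)$ is normalized on an open $W\subset M$, there are a unique open $V\subset M$ and a unique diffeomorphism $\tau_{W,a}:V\to W$ with $T_a(C_c^\infty(W))=C_c^\infty(V)$ and $T_a(f)=f\circ\tau_{W,a}$ on $V$ for all $f\in C_c^\infty(W)$. 2. $\mathcal G_{sp}(A)$ is open in $\mathcal E_{sp}(A)$, and the sets $a_W$, for $a\in G^S_w(A)$ normalized on an open $W$, form a basis of its topology. Whenever $a\in G_w^S(A)$ is normalized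 at $y$, the class $a_y$ is an arrow. 3. $\mathcal G_{sp}(A)$ is an étale Lie groupoid over $M$ with the following (well defined) structure maps. The target of $a_y$ is $y$ (so the smooth structure is the one for which the sheaf projection is a local diffeomorphism). The source of $a_y$ is $\tau_{W,a}^{-1}(y)$ for any open $W\ni y$ on which $a$ is normalized. The product is $b_z\,a_y=(ba)_z$ when the source of $b_z$ is $y$. The unit at $y$ is $f_y$ for any $f\in C_c^\infty(M)$ equal to $1$ near $y$. The inverse is $(a_y)^{-1}=(S(a))_x$, where $x$ is the source of $a_y$. 4. For any homomorphism $\alpha:A\to B$ of Hopf algebroids over $C_c^\infty(M)$, $\mathcal E_{sp}(\alpha)$ restricts to a morphism of étale Lie groupoids $\mathcal G_{sp}(\alpha):\mathcal G_{sp}(A)\to\mathcal G_{sp}(B)$, and this gives a functor from the category of Hopf algebroids over $C_c^\infty(M)$ to the category of étale Lie groupoids over $M$. -/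

import Mathlib

open Filter Topology TensorProduct TopologicalSpace CategoryTheory
open scoped Manifold ContDiff

universe u v w

noncomputable section

/-! ## Balanced tensor products over a ring without identity -/

section Balanced

variable {𝕜 : Type*} [Field 𝕜] {R : Type*} {P : Type*} [AddCommGroup P] [Module 𝕜 P]
  {Q : Type*} [AddCommGroup Q] [Module 𝕜 Q]

/-- The subspace of `P ⊗ P` spanned by all `r p ⊗ q - p ⊗ r q`, where `r p` is `act r p`. -/
def balancedSubmodule (act : R → P →ₗ[𝕜] P) : Submodule 𝕜 (P ⊗[𝕜] P) :=
  Submodule.span 𝕜 {z | ∃ (r : R) (p q : P), z = act r p ⊗ₜ[𝕜] q - p ⊗ₜ[𝕜] act r q}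

/-- The tensor product `P ⊗_R P` of an `R`-module (with the action `act`) with itself, as the
quotient of the tensor product over the base field. -/
abbrev BalancedTensor (act : R → P →ₗ[𝕜] P) : Type _ := (P ⊗[𝕜] P) ⧸ balancedSubmodule act

/-- The class of the tensor `p ⊗ q`. -/
def BalancedTensor.tmul (act : R → P →ₗ[𝕜] P) (p q : P) : BalancedTensor act :=
  (balancedSubmodule act).mkQ (p ⊗ₜ[𝕜] q)

/-- The map `f ⊗ g : P ⊗_R P → Q ⊗_R Q` induced by two `R`-linear maps. -/
def BalancedTensor.map {actP : R → P →ₗ[𝕜] P} {actQ : R → Q →ₗ[𝕜] Q} (f g : P →ₗ[𝕜] Q)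
    (hf : ∀ r p, f (actP r p) = actQ r (f p)) (hg : ∀ r p, g (actP r p) = actQ r (g p)) :
    BalancedTensor actP →ₗ[𝕜] BalancedTensor actQ :=
  (balancedSubmodule actP).mapQ (balancedSubmodule actQ) (TensorProduct.map f g) (by
    rw [balancedSubmodule, Submodule.span_le]
    rintro z ⟨r, p, q, rfl⟩
    refine Submodule.subset_span ⟨r, f p, g q, ?_⟩
    simp [hf, hg])

theorem BalancedTensor.map_tmul {actP : R → P →ₗ[𝕜] P} {actQ : R → Q →ₗ[𝕜] Q}
    (f g : P →ₗ[𝕜] Q)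
    (hf : ∀ r p, f (actP r p) = actQ r (f p)) (hg : ∀ r p, g (actP r p) = actQ r (g p))
    (p q : P) : BalancedTensor.map f g hf hg (BalancedTensor.tmul actP p q) =
      BalancedTensor.tmul actQ (f p) (g q) := rfl

/-- Every element of `P ⊗_R P` is the class of an element of `P ⊗ P`; two linear maps which
agree on the classes of elementary tensors agree. -/
theorem BalancedTensor.hom_ext {act : R → P →ₗ[𝕜] P} {f g : BalancedTensor act →ₗ[𝕜] Q}
    (h : ∀ p q, f (BalancedTensor.tmul act p q) = g (BalancedTensor.tmul act p q)) : f = g := by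
  refine Submodule.linearMap_qext _ (TensorProduct.ext' fun p q => h p q)

end Balanced

/-! ## Hopf algebroids over a commutative algebra, possibly without identity -/

section Bimodule

variable {𝕜 : Type*} [Field 𝕜] {R : Type*} [NonUnitalCommRing R] [Module 𝕜 R]
  {A : Type*} [NonUnitalRing A] [Module 𝕜 A] [IsScalarTower 𝕜 A A] [SMulCommClass 𝕜 A A]

set_option linter.unusedSectionVars false

/-- The left action `a ↦ r a` of the subalgebra `R` on `A`. -/
def leftAct (ι : R →ₙₐ[𝕜] A) (r : R) : A →ₗ[𝕜] A := LinearMap.mulLeft 𝕜 (ι r)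

/-- The right action `a ↦ a r` of the subalgebra `R` on `A`. -/
def rightAct (ι : R →ₙₐ[𝕜] A) (r : R) : A →ₗ[𝕜] A := LinearMap.mulRight 𝕜 (ι r)

theorem leftAct_comm (ι : R →ₙₐ[𝕜] A) (r s : R) (a : A) :
    leftAct ι r (leftAct ι s a) = leftAct ι s (leftAct ι r a) := by
  simp only [leftAct, LinearMap.mulLeft_apply]
  rw [← mul_assoc, ← mul_assoc, ← map_mul, ← map_mul, mul_comm]

theorem rightAct_leftAct (ι : R →ₙₐ[𝕜] A) (r s : R) (a : A) :
    rightAct ι r (leftAct ι s a) = leftAct ι s (rightAct ι r a) := by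
  simp only [leftAct, rightAct, LinearMap.mulLeft_apply, LinearMap.mulRight_apply, mul_assoc]

/-- The tensor product `A ⊗ A` with respect to the left action of `R` on both factors. -/
abbrev TensorLL (ι : R →ₙₐ[𝕜] A) : Type _ := BalancedTensor (leftAct ι)

/-- The class in `TensorLL ι` of an element of the tensor product over the base field. -/
def TensorLL.mk (ι : R →ₙₐ[𝕜] A) : A ⊗[𝕜] A →ₗ[𝕜] TensorLL ι :=
  (balancedSubmodule (leftAct ι)).mkQ

/-- The left action of `R` on `TensorLL ι`: `r (a ⊗ b) = r a ⊗ b`. -/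
def TensorLL.left (ι : R →ₙₐ[𝕜] A) (r : R) : TensorLL ι →ₗ[𝕜] TensorLL ι :=
  BalancedTensor.map (leftAct ι r) LinearMap.id (fun s a => leftAct_comm ι r s a)
    (fun _ _ => rfl)

/-- The first right action of `R` on `TensorLL ι`: `(a ⊗ b) r = a r ⊗ b`. -/
def TensorLL.rightFst (ι : R →ₙₐ[𝕜] A) (r : R) : TensorLL ι →ₗ[𝕜] TensorLL ι :=
  BalancedTensor.map (rightAct ι r) LinearMap.id (fun s a => rightAct_leftAct ι r s a)
    (fun _ _ => rfl)

/-- The second right action of `R` on `TensorLL ι`: `(a ⊗ b) r = a ⊗ b r`. -/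
def TensorLL.rightSnd (ι : R →ₙₐ[𝕜] A) (r : R) : TensorLL ι →ₗ[𝕜] TensorLL ι :=
  BalancedTensor.map LinearMap.id (rightAct ι r) (fun _ _ => rfl)
    (fun s a => rightAct_leftAct ι r s a)

end Bimodule

/-- A Hopf algebroid over a commutative `𝕜`-algebra `R`: an associative `𝕜`-algebra (perhaps
without identity) which contains `R` as a subalgebra (through `ι`), has local identities in `R`,
and carries a comultiplication, a counit and an antipode.

The maps `id ⊗ ε`, `ε ⊗ id`, `μ ∘ (S ⊗ id)` and the product of `ΔA` with `TensorLL ι` are all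
induced from the tensor product over `𝕜`; the corresponding axioms are written for all
representatives `X ∈ A ⊗ A` of the tensors concerned. -/
structure HopfAlgebroid (𝕜 : Type*) [Field 𝕜] (R : Type*) [NonUnitalCommRing R] [Module 𝕜 R] where
  /-- the underlying algebra -/
  carrier : Type v
  [ring : NonUnitalRing carrier]
  [module : Module 𝕜 carrier]
  [scalarTower : IsScalarTower 𝕜 carrier carrier]
  [smulComm : SMulCommClass 𝕜 carrier carrier]
  /-- the inclusion of the commutative subalgebra -/
  ι : R →ₙₐ[𝕜] carrier
  ι_injective : Function.Injective ι
  local_identities : ∀ s : Finset carrier, ∃ r : R, ∀ a ∈ s, ι r * a = a ∧ a * ι r = a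
  /-- the comultiplication -/
  comul : carrier →ₗ[𝕜] TensorLL ι
  /-- the counit -/
  counit : carrier →ₗ[𝕜] R
  /-- the antipode -/
  antipode : carrier →ₗ[𝕜] carrier
  comul_left : ∀ r a, comul (ι r * a) = TensorLL.left ι r (comul a)
  counit_left : ∀ r a, counit (ι r * a) = r * counit a
  id_tensor_counit : ∀ a X, TensorLL.mk ι X = comul a →
    TensorProduct.lift ((LinearMap.mul 𝕜 carrier).flip.compl₂
      ((ι : R →ₗ[𝕜] carrier) ∘ₗ counit)) X = a
  counit_tensor_id : ∀ a X, TensorLL.mk ι X = comul a →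
    TensorProduct.lift ((LinearMap.mul 𝕜 carrier) ∘ₗ ((ι : R →ₗ[𝕜] carrier) ∘ₗ counit)) X = a
  counit_ι : ∀ r, counit (ι r) = r
  comul_ι : ∀ r s, comul (ι (r * s)) = TensorLL.mk ι (ι r ⊗ₜ[𝕜] ι s)
  rightFst_comul : ∀ r a, TensorLL.rightFst ι r (comul a) = TensorLL.rightSnd ι r (comul a)
  comul_mul : ∀ a b X Y, TensorLL.mk ι X = comul a → TensorLL.mk ι Y = comul b →
    comul (a * b) = TensorLL.mk ι (X * Y)
  antipode_ι : ∀ r, antipode (ι r) = ι r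
  antipode_antipode : ∀ a, antipode (antipode a) = a
  antipode_mul : ∀ a b, antipode (a * b) = antipode b * antipode a
  mul_antipode : ∀ a X, TensorLL.mk ι X = comul a →
    TensorProduct.lift ((LinearMap.mul 𝕜 carrier) ∘ₗ antipode) X = ι (counit (antipode a))

attribute [instance] HopfAlgebroid.ring HopfAlgebroid.module HopfAlgebroid.scalarTower
  HopfAlgebroid.smulComm

namespace HopfAlgebroid

section General

variable {𝕜 : Type*} [Field 𝕜] {R : Type*} [NonUnitalCommRing R] [Module 𝕜 R]

/-- A homomorphism of Hopf algebroids over `R`. -/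
@[ext]
structure Hom (A B : HopfAlgebroid.{v} 𝕜 R) where
  /-- the underlying homomorphism of algebras -/
  toAlgHom : A.carrier →ₙₐ[𝕜] B.carrier
  map_ι : ∀ r, toAlgHom (A.ι r) = B.ι r
  counit_map : ∀ a, B.counit (toAlgHom a) = A.counit a
  comul_map : ∀ a, B.comul (toAlgHom a) =
    BalancedTensor.map (toAlgHom : A.carrier →ₗ[𝕜] B.carrier)
      (toAlgHom : A.carrier →ₗ[𝕜] B.carrier)
      (fun r b => by simp [leftAct, map_ι]) (fun r b => by simp [leftAct, map_ι]) (A.comul a)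
  antipode_map : ∀ a, B.antipode (toAlgHom a) = toAlgHom (A.antipode a)

/-- The identity homomorphism. -/
def Hom.id (A : HopfAlgebroid.{v} 𝕜 R) : Hom A A where
  toAlgHom := NonUnitalAlgHom.id 𝕜 A.carrier
  map_ι _ := rfl
  counit_map _ := rfl
  comul_map a := by
    refine LinearMap.congr_fun (f := LinearMap.id) ?_ (A.comul a)
    exact BalancedTensor.hom_ext fun p q => rfl
  antipode_map _ := rfl

/-- The composition of homomorphisms. -/
def Hom.comp {A B C : HopfAlgebroid.{v} 𝕜 R} (α : Hom A B) (β : Hom B C) : Hom A C where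
  toAlgHom := β.toAlgHom.comp α.toAlgHom
  map_ι r := by simp [α.map_ι, β.map_ι]
  counit_map a := by simp [α.counit_map, β.counit_map]
  comul_map a := by
    rw [NonUnitalAlgHom.comp_apply, β.comul_map, α.comul_map]
    rw [← LinearMap.comp_apply]
    refine LinearMap.congr_fun ?_ (A.comul a)
    exact BalancedTensor.hom_ext fun p q => rfl
  antipode_map a := by simp [α.antipode_map, β.antipode_map]

/-- The category of Hopf algebroids over `R`. -/
instance : Category (HopfAlgebroid.{v} 𝕜 R) where
  Hom := Hom
  id := Hom.id
  comp := Hom.comp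
  id_comp _ := rfl
  comp_id _ := rfl
  assoc _ _ _ := rfl

variable (A : HopfAlgebroid.{v} 𝕜 R)

/-- The tensor `a ⊗ b` over the left action of `R` on both factors. -/
def tmul (a b : A.carrier) : TensorLL A.ι := BalancedTensor.tmul (leftAct A.ι) a b

/-- The weakly grouplike elements: `Δ a = a ⊗ a'` for some `a'`. -/
def weaklyGrouplike : Set A.carrier := {a | ∃ a', A.comul a = A.tmul a a'}

/-- The `S`-invariant weakly grouplike elements: `Δ a = a ⊗ a'` and `Δ (S a) = S a' ⊗ S a` for
some `a'`. -/
def invariantWeaklyGrouplike : Set A.carrier :=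
  {a | ∃ a', A.comul a = A.tmul a a' ∧
    A.comul (A.antipode a) = A.tmul (A.antipode a') (A.antipode a)}

/-- The map `T_a : R → R`, `T_a f = ε (S (f a))`. -/
def T (a : A.carrier) : R →ₗ[𝕜] R :=
  A.counit ∘ₗ A.antipode ∘ₗ LinearMap.mulRight 𝕜 a ∘ₗ (A.ι : R →ₗ[𝕜] A.carrier)

variable {A}

theorem Hom.map_invariantWeaklyGrouplike {B : HopfAlgebroid.{v} 𝕜 R} (α : A ⟶ B)
    {a : A.carrier} (ha : a ∈ A.invariantWeaklyGrouplike) :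
    Hom.toAlgHom α a ∈ B.invariantWeaklyGrouplike := by
  obtain ⟨a', h₁, h₂⟩ := ha
  refine ⟨Hom.toAlgHom α a', ?_, ?_⟩
  · rw [Hom.comul_map, h₁]; rfl
  · rw [Hom.antipode_map, Hom.antipode_map, Hom.comul_map, h₂]; rfl

end General

end HopfAlgebroid

/-! ## Smooth functions with compact support -/

/-- The algebra of `𝕜`-valued smooth functions with compact support on a manifold modelled
on `E`. -/
def SmoothCc (𝕜 : Type*) [RCLike 𝕜] (E : Type*) [NormedAddCommGroup E] [NormedSpace ℝ E]
    (M : Type*) [TopologicalSpace M] [ChartedSpace E M] : NonUnitalSubalgebra 𝕜 (M → 𝕜) where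
  carrier := {f | ContMDiff 𝓘(ℝ, E) 𝓘(ℝ, 𝕜) ∞ f ∧ HasCompactSupport f}
  add_mem' hf hg := ⟨hf.1.add hg.1, hf.2.add hg.2⟩
  zero_mem' := ⟨contMDiff_const, HasCompactSupport.zero⟩
  mul_mem' hf hg :=
    ⟨(contDiff_mul (𝕜 := ℝ) (𝔸 := 𝕜)).contMDiff.comp (hf.1.prodMk_space hg.1), hf.2.mul_right⟩
  smul_mem' c f hf := by
    refine ⟨(contDiff_mul (𝕜 := ℝ) (𝔸 := 𝕜)).contMDiff.comp
      ((contMDiff_const (c := c)).prodMk_space hf.1), ?_⟩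
    exact HasCompactSupport.mul_left (f := fun _ => c) hf.2

section Manifold

variable {𝕜 : Type*} [RCLike 𝕜] {E : Type*} [NormedAddCommGroup E] [NormedSpace ℝ E]
  {M : Type u} [TopologicalSpace M] [ChartedSpace E M]

/-- The subset of the functions whose support is a (compact) subset of `W`; for an open `W` this
is the algebra of smooth functions with compact support on `W`, extended by zero. -/
def SmoothCc.supportedIn (W : Opens M) : Set (SmoothCc 𝕜 E M) := {f | tsupport f.1 ⊆ W}

/-- `f` equals `1` on a neighbourhood of `x`, i.e. the germ of `f` at `x` is `1`. -/
def SmoothCc.GermOne (f : SmoothCc 𝕜 E M) (x : M) : Prop := ∀ᶠ y in 𝓝 x, f.1 y = 1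

/-- The germ at `x`, as a linear map. -/
def SmoothCc.germ (x : M) : SmoothCc 𝕜 E M →ₗ[𝕜] Germ (𝓝 x) 𝕜 where
  toFun f := (f.1 : Germ (𝓝 x) 𝕜)
  map_add' _ _ := rfl
  map_smul' _ _ := rfl

theorem SmoothCc.exists_germOne [FiniteDimensional ℝ E] [T2Space M] [IsManifold 𝓘(ℝ, E) ∞ M]
    {x : M} {U : Set M} (hU : U ∈ 𝓝 x) :
    ∃ f : SmoothCc 𝕜 E M, SmoothCc.GermOne f x ∧ ∀ y, f.1 y ≠ 0 → y ∈ U := by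
  obtain ⟨b, hb⟩ : ∃ b : SmoothBumpFunction 𝓘(ℝ, E) x, Function.support b ⊆ U := by
    obtain ⟨b, -, hb⟩ := (SmoothBumpFunction.nhds_basis_support (I := 𝓘(ℝ, E)) hU).mem_iff.1 hU
    exact ⟨b, hb⟩
  refine ⟨⟨fun y => ((b y : ℝ) : 𝕜), ?_, ?_⟩, ?_, ?_⟩
  · have h : ContMDiff 𝓘(ℝ, ℝ) 𝓘(ℝ, 𝕜) ∞ (fun t : ℝ => (t : 𝕜)) :=
      (RCLike.ofRealCLM (K := 𝕜)).contDiff.contMDiff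
    exact h.comp b.contMDiff
  · exact b.hasCompactSupport.comp_left (g := fun t : ℝ => (t : 𝕜)) (by simp)
  · filter_upwards [b.eventuallyEq_one] with y hy
    simp [hy]
  · intro y hy
    apply hb
    intro h0
    apply hy
    simp [h0]

end Manifold

/-! ## The local coalgebras, the spectral sheaf and the arrows of a Hopf algebroid -/

namespace HopfAlgebroid

section Spectral

variable {𝕜 : Type*} [RCLike 𝕜] {E : Type*} [NormedAddCommGroup E] [NormedSpace ℝ E]
  [FiniteDimensional ℝ E] {M : Type u} [TopologicalSpace M] [T2Space M] [ChartedSpace E M]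
  [IsManifold 𝓘(ℝ, E) ∞ M] (A : HopfAlgebroid.{v} 𝕜 (SmoothCc 𝕜 E M))

/-- The subspace `N_x(A)` of all `a` with `f a = 0` for some `f` which equals `1` near `x`. -/
def germKer (x : M) : Submodule 𝕜 A.carrier where
  carrier := {a | ∃ f : SmoothCc 𝕜 E M, SmoothCc.GermOne f x ∧ A.ι f * a = 0}
  zero_mem' := by
    obtain ⟨f, hf, -⟩ := SmoothCc.exists_germOne (𝕜 := 𝕜) (E := E) (x := x) univ_mem
    exact ⟨f, hf, mul_zero _⟩
  add_mem' := by
    rintro a b ⟨f, hf, hfa⟩ ⟨g, hg, hgb⟩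
    refine ⟨f * g, ?_, ?_⟩
    · filter_upwards [hf, hg] with y h₁ h₂
      change f.1 y * g.1 y = 1
      rw [h₁, h₂, one_mul]
    · rw [mul_add, map_mul, mul_assoc (A.ι f) (A.ι g) b, hgb, ← map_mul, mul_comm f g, map_mul,
        mul_assoc, hfa, mul_zero, mul_zero, add_zero]
  smul_mem' := by
    rintro c a ⟨f, hf, hfa⟩
    exact ⟨f, hf, by rw [mul_smul_comm, hfa, smul_zero]⟩

/-- The localization `A_x = A / N_x(A)`. -/
abbrev Stalk (x : M) : Type v := A.carrier ⧸ A.germKer x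

/-- The class `a_x` of `a` in `A_x`. -/
def germ (x : M) : A.carrier →ₗ[𝕜] A.Stalk x := (A.germKer x).mkQ

/-- The left action of `R` on `A_x`. -/
def stalkAct (x : M) (r : SmoothCc 𝕜 E M) : A.Stalk x →ₗ[𝕜] A.Stalk x :=
  (A.germKer x).mapQ (A.germKer x) (leftAct A.ι r) (by
    rintro a ⟨f, hf, hfa⟩
    refine ⟨f, hf, ?_⟩
    change A.ι f * (A.ι r * a) = 0
    rw [← mul_assoc, ← map_mul, mul_comm f r, map_mul, mul_assoc, hfa, mul_zero])

theorem stalkAct_of_germOne {x : M} {f : SmoothCc 𝕜 E M}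
    (hf : SmoothCc.GermOne f x) (ζ : A.Stalk x) :
    A.stalkAct x f ζ = ζ := by
  obtain ⟨a, rfl⟩ := (A.germKer x).mkQ_surjective ζ
  obtain ⟨q, hq, hqf⟩ := SmoothCc.exists_germOne (𝕜 := 𝕜) (E := E) hf
  have h : q * f = q := by
    ext y
    change q.1 y * f.1 y = q.1 y
    by_cases hy : q.1 y = 0
    · rw [hy, zero_mul]
    · have : f.1 y = 1 := hqf y hy
      rw [this, mul_one]
  change (A.germKer x).mkQ (A.ι f * a) = (A.germKer x).mkQ a
  rw [← sub_eq_zero, ← map_sub, Submodule.mkQ_apply, Submodule.Quotient.mk_eq_zero]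
  refine ⟨q, hq, ?_⟩
  rw [mul_sub, ← mul_assoc, ← map_mul, h, sub_self]

/-- The tensor product `A_x ⊗ A_x` over `R`; since `R → R_x` is surjective, it is also the tensor
product over the ring `R_x` of germs. -/
abbrev StalkTensor (x : M) : Type _ := BalancedTensor (A.stalkAct x)

/-- The map `A ⊗ A → A_x ⊗ A_x` between tensor products over `R`. -/
def germTensor (x : M) : TensorLL A.ι →ₗ[𝕜] A.StalkTensor x :=
  BalancedTensor.map (A.germ x) (A.germ x) (fun _ _ => rfl) (fun _ _ => rfl)

theorem germTensor_left {x : M} {f : SmoothCc 𝕜 E M}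
    (hf : SmoothCc.GermOne f x) (z : TensorLL A.ι) :
    A.germTensor x (TensorLL.left A.ι f z) = A.germTensor x z := by
  rw [← LinearMap.comp_apply]
  refine LinearMap.congr_fun (BalancedTensor.hom_ext fun p q => ?_) z
  change BalancedTensor.tmul _ (A.stalkAct x f (A.germ x p)) (A.germ x q) = _
  rw [A.stalkAct_of_germOne hf]
  rfl

/-- The comultiplication `Δ_x : A_x → A_x ⊗ A_x` of the local coalgebra at `x`. -/
def stalkComul (x : M) : A.Stalk x →ₗ[𝕜] A.StalkTensor x :=
  (A.germKer x).liftQ (A.germTensor x ∘ₗ A.comul) (by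
    rintro a ⟨f, hf, hfa⟩
    rw [LinearMap.mem_ker, LinearMap.comp_apply, ← A.germTensor_left hf, ← A.comul_left, hfa,
      map_zero, map_zero])

/-- The counit `ε_x : A_x → R_x` of the local coalgebra at `x`. -/
def stalkCounit (x : M) : A.Stalk x →ₗ[𝕜] Germ (𝓝 x) 𝕜 :=
  (A.germKer x).liftQ (SmoothCc.germ x ∘ₗ A.counit) (by
    rintro a ⟨f, hf, hfa⟩
    have h : f * A.counit a = 0 := by rw [← A.counit_left, hfa, map_zero]
    rw [LinearMap.mem_ker, LinearMap.comp_apply]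
    refine Germ.coe_eq.2 ?_
    filter_upwards [hf] with y hy
    have h' : f.1 y * (A.counit a).1 y = 0 := congrFun (congrArg Subtype.val h) y
    rwa [hy, one_mul] at h')

/-- The grouplike elements of the local coalgebra `A_x`. -/
def grouplike (x : M) : Set (A.Stalk x) :=
  {ζ | A.stalkComul x ζ = BalancedTensor.tmul (A.stalkAct x) ζ ζ ∧ A.stalkCounit x ζ = 1}

/-- `a` is normalized at `x`: the function `ε a` equals `1` near `x`. -/
def NormalizedAt (a : A.carrier) (x : M) : Prop := SmoothCc.GermOne (A.counit a) x

/-- `a` is normalized on `W`. -/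
def NormalizedOn (a : A.carrier) (W : Opens M) : Prop := ∀ x ∈ W, A.NormalizedAt a x

/-- The (total space of the) spectral sheaf: its stalk at `x` is the set of grouplike elements
of `A_x`. -/
def SpectralSheaf : Type (max u v) := Σ x : M, A.grouplike x

variable {A} in
/-- The projection of the spectral sheaf. -/
def SpectralSheaf.proj (ζ : A.SpectralSheaf) : M := ζ.1

variable {A} in
/-- The grouplike element of the stalk given by a point of the spectral sheaf. -/
def SpectralSheaf.val (ζ : A.SpectralSheaf) : A.Stalk ζ.proj := ζ.2.1

/-- The subset `c_W` of the spectral sheaf, consisting of the germs `c_x`, `x ∈ W`. -/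
def basicSet (c : A.carrier) (W : Opens M) : Set A.SpectralSheaf :=
  {ζ | ζ.proj ∈ W ∧ ζ.val = A.germ ζ.proj c}

/-- The topology of the spectral sheaf: it is generated by the sets `c_W`, for `c` weakly
grouplike and normalized on an open subset `W`. -/
instance : TopologicalSpace A.SpectralSheaf :=
  TopologicalSpace.generateFrom
    {s | ∃ (c : A.carrier) (W : Opens M), c ∈ A.weaklyGrouplike ∧ A.NormalizedOn c W ∧
      s = A.basicSet c W}

/-- The arrows: the elements of the spectral sheaf of the form `a_y`, for an `S`-invariant
weakly grouplike element `a` normalized at `y`. -/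
def arrows : Set A.SpectralSheaf :=
  {ζ | ∃ a ∈ A.invariantWeaklyGrouplike, A.NormalizedAt a ζ.proj ∧ ζ.val = A.germ ζ.proj a}

/-- The sheaf of arrows, with the topology of a subspace of the spectral sheaf. -/
abbrev Gsp : Type (max u v) := A.arrows

variable {A} in
/-- `g` is the arrow `a_y` represented by the `S`-invariant weakly grouplike element `a`
normalized at the target `y` of `g`. -/
def Gsp.IsRepresentedBy (g : A.Gsp) (a : A.carrier) : Prop :=
  a ∈ A.invariantWeaklyGrouplike ∧ A.NormalizedAt a g.1.proj ∧ g.1.val = A.germ g.1.proj a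

/-- The diffeomorphism `τ : V → W` is induced by `T_a`: it satisfies
`T_a (C_c^∞(W)) = C_c^∞(V)` and `T_a f = f ∘ τ` for all `f ∈ C_c^∞(W)`. -/
structure IsInduced (a : A.carrier) (W V : Opens M)
    (τ : Diffeomorph 𝓘(ℝ, E) 𝓘(ℝ, E) V W ∞) : Prop where
  image_eq : A.T a '' SmoothCc.supportedIn W = SmoothCc.supportedIn V
  apply_eq : ∀ f ∈ SmoothCc.supportedIn (𝕜 := 𝕜) (E := E) W, ∀ x : V,
    (A.T a f).1 x = f.1 (τ x)

variable {A} {B : HopfAlgebroid.{v} 𝕜 (SmoothCc 𝕜 E M)}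

/-- The map `α_x : A_x → B_x` induced by a homomorphism. -/
def stalkMap (α : A ⟶ B) (x : M) : A.Stalk x →ₗ[𝕜] B.Stalk x :=
  (A.germKer x).mapQ (B.germKer x) (Hom.toAlgHom α : A.carrier →ₗ[𝕜] B.carrier) (by
    rintro a ⟨f, hf, hfa⟩
    refine ⟨f, hf, ?_⟩
    change B.ι f * Hom.toAlgHom α a = 0
    rw [← Hom.map_ι α, ← map_mul, hfa, map_zero])

theorem stalkMap_grouplike (α : A ⟶ B) {x : M} {ζ : A.Stalk x} (hζ : ζ ∈ A.grouplike x) :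
    stalkMap α x ζ ∈ B.grouplike x := by
  obtain ⟨h₁, h₂⟩ := hζ
  have hact : ∀ r (ξ : A.Stalk x),
      stalkMap α x (A.stalkAct x r ξ) = B.stalkAct x r (stalkMap α x ξ) := by
    intro r ξ
    obtain ⟨a, rfl⟩ := (A.germKer x).mkQ_surjective ξ
    change B.germ x (Hom.toAlgHom α (A.ι r * a)) = B.germ x (B.ι r * Hom.toAlgHom α a)
    rw [map_mul, Hom.map_ι]
  have key : ∀ ξ : A.Stalk x, B.stalkComul x (stalkMap α x ξ) =
      BalancedTensor.map (stalkMap α x) (stalkMap α x) hact hact (A.stalkComul x ξ) := by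
    intro ξ
    obtain ⟨a, rfl⟩ := (A.germKer x).mkQ_surjective ξ
    change B.germTensor x (B.comul (Hom.toAlgHom α a)) =
      BalancedTensor.map (stalkMap α x) (stalkMap α x) hact hact (A.germTensor x (A.comul a))
    have h : B.germTensor x ∘ₗ BalancedTensor.map (Hom.toAlgHom α : A.carrier →ₗ[𝕜] B.carrier)
        (Hom.toAlgHom α : A.carrier →ₗ[𝕜] B.carrier)
        (actP := leftAct A.ι) (actQ := leftAct B.ι)
        (fun r b => by simp [leftAct, Hom.map_ι]) (fun r b => by simp [leftAct, Hom.map_ι]) =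
      BalancedTensor.map (stalkMap α x) (stalkMap α x) hact hact ∘ₗ A.germTensor x :=
      BalancedTensor.hom_ext fun p q => rfl
    rw [Hom.comul_map]
    exact LinearMap.congr_fun h (A.comul a)
  refine ⟨?_, ?_⟩
  · rw [key, h₁]
    rfl
  · obtain ⟨a, rfl⟩ := (A.germKer x).mkQ_surjective ζ
    rw [← h₂]
    change SmoothCc.germ x (B.counit (Hom.toAlgHom α a)) = SmoothCc.germ x (A.counit a)
    rw [Hom.counit_map]

/-- The map of spectral sheaves induced by a homomorphism: it is `α_x` on the stalk at `x`. -/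
def SpectralSheaf.map (α : A ⟶ B) (ζ : A.SpectralSheaf) : B.SpectralSheaf :=
  ⟨ζ.proj, stalkMap α ζ.proj ζ.val, stalkMap_grouplike α ζ.2.2⟩

/-- The restriction of the map of spectral sheaves to the arrows. -/
def Gsp.map (α : A ⟶ B) (g : A.Gsp) : B.Gsp :=
  ⟨SpectralSheaf.map α g.1, by
    obtain ⟨a, ha, hn, hg⟩ := g.2
    refine ⟨Hom.toAlgHom α a, Hom.map_invariantWeaklyGrouplike α ha, ?_, ?_⟩
    · change SmoothCc.GermOne (B.counit (Hom.toAlgHom α a)) g.1.proj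
      rw [Hom.counit_map]
      exact hn
    · change stalkMap α g.1.proj g.1.val = _
      rw [hg]
      rfl⟩

end Spectral

end HopfAlgebroid

/-! ## Étale Lie groupoids -/

/-- The structure of an étale Lie groupoid over the manifold `M` on a topological space `G`
(not necessarily Hausdorff): a smooth structure on `G` and a groupoid structure with objects `M`
and arrows `G`, all of whose structure maps are local diffeomorphisms.

The smooth structure on the fibred product `{(g, h) | s g = t h}` is the unique one (up to the
choice of an atlas), on the subspace of `G × G`, for which both projections to `G` are local
diffeomorphisms. -/
structure EtaleLieGroupoid (E : Type*) [NormedAddCommGroup E] [NormedSpace ℝ E]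
    (M : Type*) [TopologicalSpace M] [ChartedSpace E M]
    (G : Type w) [TopologicalSpace G] where
  [charted : ChartedSpace E G]
  [isManifold : IsManifold 𝓘(ℝ, E) ∞ G]
  /-- the source map -/
  source : G → M
  /-- the target map -/
  target : G → M
  /-- the unit map -/
  unit : M → G
  /-- the inverse map -/
  inv : G → G
  /-- the multiplication, `mul ⟨(g, h), _⟩ = g h` -/
  mul : {p : G × G // source p.1 = target p.2} → G
  source_unit : ∀ x, source (unit x) = x
  target_unit : ∀ x, target (unit x) = x
  source_inv : ∀ g, source (inv g) = target g
  target_inv : ∀ g, target (inv g) = source g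
  source_mul : ∀ p, source (mul p) = source p.1.2
  target_mul : ∀ p, target (mul p) = target p.1.1
  mul_assoc : ∀ g h k (hgh : source g = target h) (hhk : source h = target k),
    mul ⟨(mul ⟨(g, h), hgh⟩, k), (source_mul _).trans hhk⟩ =
      mul ⟨(g, mul ⟨(h, k), hhk⟩), hgh.trans (target_mul ⟨(h, k), hhk⟩).symm⟩
  unit_mul : ∀ g, mul ⟨(unit (target g), g), source_unit _⟩ = g
  mul_unit : ∀ g, mul ⟨(g, unit (source g)), (target_unit _).symm⟩ = g
  inv_mul : ∀ g, mul ⟨(inv g, g), source_inv g⟩ = unit (source g)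
  mul_inv : ∀ g, mul ⟨(g, inv g), (target_inv g).symm⟩ = unit (target g)
  source_localDiffeo : IsLocalDiffeomorph 𝓘(ℝ, E) 𝓘(ℝ, E) ∞ source
  target_localDiffeo : IsLocalDiffeomorph 𝓘(ℝ, E) 𝓘(ℝ, E) ∞ target
  unit_localDiffeo : IsLocalDiffeomorph 𝓘(ℝ, E) 𝓘(ℝ, E) ∞ unit
  inv_localDiffeo : IsLocalDiffeomorph 𝓘(ℝ, E) 𝓘(ℝ, E) ∞ inv
  mul_localDiffeo : ∃ _ : ChartedSpace E {p : G × G // source p.1 = target p.2},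
    IsManifold 𝓘(ℝ, E) ∞ {p : G × G // source p.1 = target p.2} ∧
    IsLocalDiffeomorph 𝓘(ℝ, E) 𝓘(ℝ, E) ∞
      (fun p : {p : G × G // source p.1 = target p.2} => p.1.1) ∧
    IsLocalDiffeomorph 𝓘(ℝ, E) 𝓘(ℝ, E) ∞
      (fun p : {p : G × G // source p.1 = target p.2} => p.1.2) ∧
    IsLocalDiffeomorph 𝓘(ℝ, E) 𝓘(ℝ, E) ∞ mul

/-- A morphism of étale Lie groupoids over `M`: a smooth map which preserves the groupoid
structure and is the identity on `M`. -/
structure EtaleLieGroupoid.IsMorphism {E : Type*} [NormedAddCommGroup E] [NormedSpace ℝ E]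
    {M : Type*} [TopologicalSpace M] [ChartedSpace E M]
    {G H : Type*} [TopologicalSpace G] [TopologicalSpace H]
    (𝒢 : EtaleLieGroupoid E M G) (ℋ : EtaleLieGroupoid E M H) (φ : G → H) : Prop where
  smooth : letI := 𝒢.charted; letI := ℋ.charted; ContMDiff 𝓘(ℝ, E) 𝓘(ℝ, E) ∞ φ
  map_unit : ∀ x, φ (𝒢.unit x) = ℋ.unit x
  source_map : ∀ g, ℋ.source (φ g) = 𝒢.source g
  target_map : ∀ g, ℋ.target (φ g) = 𝒢.target g
  map_mul : ∀ g h (hgh : 𝒢.source g = 𝒢.target h),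
    φ (𝒢.mul ⟨(g, h), hgh⟩) =
      ℋ.mul ⟨(φ g, φ h), (source_map g).trans (hgh.trans (target_map h).symm)⟩

/-- An étale Lie groupoid over `M`. -/
structure EtGrpd (E : Type*) [NormedAddCommGroup E] [NormedSpace ℝ E]
    (M : Type*) [TopologicalSpace M] [ChartedSpace E M] where
  /-- the space of arrows -/
  Arr : Type w
  [topology : TopologicalSpace Arr]
  /-- the étale Lie groupoid structure -/
  groupoid : EtaleLieGroupoid E M Arr

attribute [instance] EtGrpd.topology

/-- The category of étale Lie groupoids over `M`. -/
instance {E : Type*} [NormedAddCommGroup E] [NormedSpace ℝ E]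
    {M : Type*} [TopologicalSpace M] [ChartedSpace E M] : Category (EtGrpd.{w} E M) where
  Hom 𝒢 ℋ := {φ : 𝒢.Arr → ℋ.Arr // 𝒢.groupoid.IsMorphism ℋ.groupoid φ}
  id 𝒢 := ⟨fun g => g,
    { smooth := by
        let := 𝒢.groupoid.charted
        exact contMDiff_id
      map_unit := fun _ => rfl
      source_map := fun _ => rfl
      target_map := fun _ => rfl
      map_mul := fun _ _ _ => rfl }⟩
  comp {𝒢 ℋ 𝒦} φ ψ := ⟨fun g => ψ.1 (φ.1 g),
    { smooth := by
        let := 𝒢.groupoid.charted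
        let := ℋ.groupoid.charted
        let := 𝒦.groupoid.charted
        exact ψ.2.smooth.comp φ.2.smooth
      map_unit := fun x => by rw [φ.2.map_unit, ψ.2.map_unit]
      source_map := fun g => by rw [ψ.2.source_map, φ.2.source_map]
      target_map := fun g => by rw [ψ.2.target_map, φ.2.target_map]
      map_mul := fun g h hgh => by rw [φ.2.map_mul g h hgh, ψ.2.map_mul] }⟩
  id_comp _ := rfl
  comp_id _ := rfl
  assoc _ _ _ := rfl

/-- The structure maps of the étale Lie groupoid structure `𝒢` on the sheaf of arrows of `A` are
the ones given by the operations of `A`. -/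
structure HopfAlgebroid.IsSpectralGroupoid {𝕜 : Type*} [RCLike 𝕜] {E : Type*}
    [NormedAddCommGroup E] [NormedSpace ℝ E] [FiniteDimensional ℝ E]
    {M : Type u} [TopologicalSpace M] [T2Space M] [ChartedSpace E M] [IsManifold 𝓘(ℝ, E) ∞ M]
    (A : HopfAlgebroid.{v} 𝕜 (SmoothCc 𝕜 E M)) (𝒢 : EtaleLieGroupoid E M A.Gsp) : Prop where
  /-- the target is the projection of the sheaf, `t (a_y) = y` -/
  target_eq : ∀ g, 𝒢.target g = g.1.proj
  /-- the source is `s (a_y) = τ⁻¹ y`, where `τ` is induced by `T_a` -/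
  source_eq : ∀ (g : A.Gsp) (a : A.carrier), g.IsRepresentedBy a →
    ∀ (W V : Opens M) (τ : Diffeomorph 𝓘(ℝ, E) 𝓘(ℝ, E) V W ∞), A.NormalizedOn a W →
      A.IsInduced a W V τ → ∀ hg : g.1.proj ∈ W, 𝒢.source g = τ.symm ⟨g.1.proj, hg⟩
  /-- the unit arrow at `y` is `f_y`, where `f` equals `1` near `y` -/
  unit_eq : ∀ (y : M) (f : SmoothCc 𝕜 E M), SmoothCc.GermOne f y →
    (𝒢.unit y).IsRepresentedBy (A.ι f)
  /-- the product of `b_z` and `a_y` is `(b a)_z` -/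
  mul_eq : ∀ (h g : A.Gsp) (hhg : 𝒢.source h = 𝒢.target g) (b a : A.carrier),
    h.IsRepresentedBy b → g.IsRepresentedBy a →
      Gsp.IsRepresentedBy (𝒢.mul ⟨(h, g), hhg⟩) (b * a)
  /-- the inverse of `a_y` is `(S a)_x`, where `x` is the source of `a_y` -/
  inv_eq : ∀ (g : A.Gsp) (a : A.carrier), g.IsRepresentedBy a →
    Gsp.IsRepresentedBy (𝒢.inv g) (A.antipode a)

end

/-! Let `Δ a = a ⊗ a'` and `Δ (S a) = S a' ⊗ S a`. The counit and antipode axioms give `S(a) a' =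
ε(S a)`, `a' S(a) = ε(a)` and `T_a f = S(a) f a'`. So `T_a` is conjugation by `a`. It is
multiplicative up to the factor `ε(a)`, and `T_{S a}` inverts it up to the same kind of factor
(`T_mul_T`, `T_mul_counit`, `T_antipode_T`).

Where `ε(a)(y) = 1` these factors disappear, and `g ↦ (T_{S a} g)(y)` is a nonzero character of
`C_c^∞(M)`. By compactness every such character is evaluation at a point `x` (`exists_eq_eval`), and
this `x` is the source of `a_y`. The relation `Links a x y` records this. It is symmetric under `S`,
compatible with products, and depends only on the germ of `a` at `y`, because `T_{S a} g = ε(a g)`.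
Smoothness of `y ↦ x` holds because its compositions with all test functions are the functions `T_{S
a} g`, which are smooth. Together with the same statement for `S a` this gives the diffeomorphism
`τ_{W,a}`.

The product and the inverse are well defined on germs by the commutation rule `T_{S a}(q) a = ε(a) a
q` (`T_antipode_mul`), which moves a cutoff at the source to one at the target. The groupoid axioms
are then checked on representatives, using `a S(a) = ε(a)²`.

The target is a local homeomorphism, so the smooth structure can be pulled back from `M`. The source
is locally the target followed by a partial diffeomorphism of `M`. Any other structure map, and any
map induced by a homomorphism, is locally represented by a single element, hence continuous. Being a
continuous lift along the target of a known local diffeomorphism, it is itself a local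
diffeomorphism (`IsLocalDiffeomorph.of_comp_left`). -/

noncomputable section

namespace HopfAlgebroid

/-! ### Algebraic identities for invariant weakly grouplike elements. -/

section Algebra

variable {𝕜 : Type*} [Field 𝕜] {R : Type*} [NonUnitalCommRing R] [Module 𝕜 R]
  {A : HopfAlgebroid.{v} 𝕜 R}

/-- The defining relations of an `S`-invariant weakly grouplike element `a`, with the second
factor `a'` of `Δ a` made explicit. -/
structure IsInvariantPair (A : HopfAlgebroid.{v} 𝕜 R) (a a' : A.carrier) : Prop where
  comul_eq : A.comul a = A.tmul a a'
  comul_antipode : A.comul (A.antipode a) = A.tmul (A.antipode a') (A.antipode a)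

theorem mem_invariantWeaklyGrouplike {a : A.carrier} :
    a ∈ A.invariantWeaklyGrouplike ↔ ∃ a', A.IsInvariantPair a a' :=
  ⟨fun ⟨a', h₁, h₂⟩ => ⟨a', h₁, h₂⟩, fun ⟨a', h⟩ => ⟨a', h.1, h.2⟩⟩

theorem invariantWeaklyGrouplike_subset : A.invariantWeaklyGrouplike ⊆ A.weaklyGrouplike :=
  fun _ ⟨a', h, _⟩ => ⟨a', h⟩

theorem tmul_left (r : R) (a b : A.carrier) :
    A.tmul (A.ι r * a) b = A.tmul a (A.ι r * b) := by
  refine (Submodule.Quotient.eq _).2 (Submodule.subset_span ⟨r, a, b, rfl⟩)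

theorem ι_counit_mul_of_comul_eq {a b c : A.carrier} (h : A.comul a = A.tmul b c) :
    A.ι (A.counit c) * b = a :=
  A.id_tensor_counit a (b ⊗ₜ c) h.symm

theorem counit_ι_mul_of_comul_eq {a b c : A.carrier} (h : A.comul a = A.tmul b c) :
    A.ι (A.counit b) * c = a :=
  A.counit_tensor_id a (b ⊗ₜ c) h.symm

theorem antipode_mul_of_comul_eq {a b c : A.carrier} (h : A.comul a = A.tmul b c) :
    A.antipode b * c = A.ι (A.counit (A.antipode a)) :=
  A.mul_antipode a (b ⊗ₜ c) h.symm

theorem comul_ι_mul_of_comul_eq {a b c : A.carrier} (r : R) (h : A.comul a = A.tmul b c) :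
    A.comul (A.ι r * a) = A.tmul (A.ι r * b) c := by
  rw [A.comul_left, h]; rfl

theorem comul_mul_of_comul_eq {a b c x y z : A.carrier} (h : A.comul a = A.tmul b c)
    (h' : A.comul x = A.tmul y z) : A.comul (a * x) = A.tmul (b * y) (c * z) :=
  (A.comul_mul a x (b ⊗ₜ c) (y ⊗ₜ z) h.symm h'.symm).trans (by
    rw [Algebra.TensorProduct.tmul_mul_tmul]; rfl)

theorem T_apply (a : A.carrier) (f : R) : A.T a f = A.counit (A.antipode (A.ι f * a)) := rfl

theorem T_ι (f g : R) : A.T (A.ι f) g = g * f := by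
  rw [T_apply, ← map_mul, A.antipode_ι, A.counit_ι]

/-- In the absence of an identity of `R`, a local identity `g` with `f g = f` serves as the second
tensor factor; commutativity of `R` gives the flipped relation. -/
theorem isInvariantPair_ι (f : R) : ∃ g, A.IsInvariantPair (A.ι f) (A.ι g) := by
  obtain ⟨g, hg⟩ := A.local_identities {A.ι f}
  have hfg : f * g = f := by
    apply A.ι_injective
    rw [map_mul]
    exact (hg _ (Finset.mem_singleton_self _)).2
  have h : A.comul (A.ι f) = A.tmul (A.ι f) (A.ι g) := by
    conv_lhs => rw [← hfg]
    exact A.comul_ι f g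
  refine ⟨g, h, ?_⟩
  have h' : A.comul (A.ι f) = A.tmul (A.ι g) (A.ι f) := by
    conv_lhs => rw [← hfg, mul_comm]
    exact A.comul_ι g f
  simpa only [A.antipode_ι] using h'

namespace IsInvariantPair

variable {a a' : A.carrier}

theorem counit_mul (h : A.IsInvariantPair a a') : A.ι (A.counit a) * a' = a :=
  counit_ι_mul_of_comul_eq h.comul_eq

theorem counit_antipode_mul (h : A.IsInvariantPair a a') :
    A.ι (A.counit (A.antipode a)) * A.antipode a' = A.antipode a :=
  ι_counit_mul_of_comul_eq h.comul_antipode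

/-- Since `S a = ε(S a) S a'`, moving the scalar `ε(S a)` across the tensor sign exchanges the
factors of `S a' ⊗ S a`; similarly `a ⊗ a' = a' ⊗ a` because `a = ε(a) a'`. This symmetry lets every
later statement be applied to `S a`. -/
theorem antipode (h : A.IsInvariantPair a a') :
    A.IsInvariantPair (A.antipode a) (A.antipode a') := by
  constructor
  · rw [h.comul_antipode]
    conv_lhs => rw [← h.counit_antipode_mul]
    rw [← tmul_left, h.counit_antipode_mul]
  · rw [A.antipode_antipode, A.antipode_antipode, h.comul_eq]
    conv_lhs => rw [← h.counit_mul]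
    rw [tmul_left, h.counit_mul]

theorem mul_counit_antipode (h : A.IsInvariantPair a a') :
    a' * A.ι (A.counit (A.antipode a)) = a := by
  have := congrArg A.antipode h.counit_antipode_mul
  simpa only [A.antipode_mul, A.antipode_antipode, A.antipode_ι] using this

/-- The antipode axiom applied to `Δ (f a) = f a ⊗ a'`. All the identities for `T` below are
computed from this conjugation formula. -/
theorem ι_T (h : A.IsInvariantPair a a') (f : R) : A.ι (A.T a f) = A.antipode a * A.ι f * a' := by
  rw [T_apply, ← antipode_mul_of_comul_eq (comul_ι_mul_of_comul_eq f h.comul_eq),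
    A.antipode_mul, A.antipode_ι]

theorem ι_T' (h : A.IsInvariantPair a a') (f : R) :
    A.ι (A.T a f) = A.antipode a' * A.ι f * a := by
  have := congrArg A.antipode (h.ι_T f)
  simpa only [A.antipode_mul, A.antipode_antipode, A.antipode_ι, mul_assoc] using this

theorem ι_T_antipode (h : A.IsInvariantPair a a') (f : R) :
    A.ι (A.T (A.antipode a) f) = a' * A.ι f * A.antipode a := by
  rw [h.antipode.ι_T', A.antipode_antipode]

theorem antipode_mul_self (h : A.IsInvariantPair a a') :
    A.antipode a * a' = A.ι (A.counit (A.antipode a)) :=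
  antipode_mul_of_comul_eq h.comul_eq

theorem mul_antipode_self (h : A.IsInvariantPair a a') :
    a' * A.antipode a = A.ι (A.counit a) := by
  have := antipode_mul_of_comul_eq h.comul_antipode
  rwa [A.antipode_antipode, A.antipode_antipode] at this

/-- The inner product `a' S(a)` in `S(a) f a' S(a) g a'` is `ε(a)`. -/
theorem T_mul_T (h : A.IsInvariantPair a a') (f g : R) :
    A.T a f * A.T a g = A.T a (f * A.counit a * g) := by
  apply A.ι_injective
  rw [map_mul, h.ι_T, h.ι_T, h.ι_T]
  simp only [map_mul, ← h.mul_antipode_self, mul_assoc]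

theorem T_mul_counit (h : A.IsInvariantPair a a') (f : R) :
    A.T a f * A.counit (A.antipode a) = A.T a (f * A.counit a) := by
  apply A.ι_injective
  rw [map_mul, h.ι_T, h.ι_T, map_mul, mul_assoc _ a', h.mul_counit_antipode]
  simp only [mul_assoc]
  rw [h.counit_mul]

theorem T_antipode_T (h : A.IsInvariantPair a a') (f : R) :
    A.T (A.antipode a) (A.T a f) = A.counit a * f * A.counit a := by
  apply A.ι_injective
  rw [h.ι_T_antipode, h.ι_T]
  simp only [map_mul, ← h.mul_antipode_self, mul_assoc]

theorem T_T_antipode (h : A.IsInvariantPair a a') (f : R) : A.T a (A.T (A.antipode a) f) =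
    A.counit (A.antipode a) * f * A.counit (A.antipode a) := by
  have := h.antipode.T_antipode_T f
  rwa [A.antipode_antipode] at this

theorem mul_counit_antipode_eq (h : A.IsInvariantPair a a') :
    a * A.ι (A.counit (A.antipode a)) = A.ι (A.counit a) * a := by
  have h₁ : a * A.ι (A.counit (A.antipode a)) =
      A.ι (A.counit a) * a' * A.ι (A.counit (A.antipode a)) := by rw [h.counit_mul]
  rw [h₁, mul_assoc, h.mul_counit_antipode]

/-- The commutation rule between `a` and functions: `a' q S(a) a = a' q ε(S a)²`, and `a' ε(S a) =
a` absorbs one factor. Where `ε(a) = 1` it says that multiplying on the right by `q` is multiplying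
on the left by `q` transported to the target. -/
theorem T_antipode_mul (h : A.IsInvariantPair a a') (q : R) :
    A.ι (A.T (A.antipode a) q) * a = A.ι (A.counit a) * a * A.ι q := by
  have h₁ : A.antipode a * a =
      A.ι (A.counit (A.antipode a)) * A.ι (A.counit (A.antipode a)) := by
    nth_rw 1 [← h.antipode_mul_self]
    rw [mul_assoc, h.mul_counit_antipode]
  rw [h.ι_T_antipode, mul_assoc, h₁, mul_assoc, ← mul_assoc (A.ι q), ← map_mul, ← map_mul,
    mul_comm q, mul_assoc, mul_comm q, ← mul_assoc, map_mul, map_mul, ← mul_assoc, ← mul_assoc,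
    h.mul_counit_antipode, h.mul_counit_antipode_eq]

theorem mul_antipode_eq (h : A.IsInvariantPair a a') :
    a * A.antipode a = A.ι (A.counit a) * A.ι (A.counit a) := by
  nth_rw 2 [← h.mul_antipode_self]
  rw [← mul_assoc, h.counit_mul]

theorem mul (h : A.IsInvariantPair a a') {b b' : A.carrier} (hb : A.IsInvariantPair b b') :
    A.IsInvariantPair (b * a) (b' * a') := by
  refine ⟨comul_mul_of_comul_eq hb.comul_eq h.comul_eq, ?_⟩
  simp only [A.antipode_mul]
  exact comul_mul_of_comul_eq h.comul_antipode hb.comul_antipode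

theorem T_mul (h : A.IsInvariantPair a a') {b b' : A.carrier} (hb : A.IsInvariantPair b b') (f : R) :
    A.T (b * a) f = A.T a (A.T b f) := by
  apply A.ι_injective
  rw [(h.mul hb).ι_T, h.ι_T, hb.ι_T, A.antipode_mul]
  simp only [mul_assoc]

/-- Here `ε(b a) = b' a' S(a) S(b) = b' ε(a) S(b)`. This controls where a product is normalized. -/
theorem counit_mul_eq (h : A.IsInvariantPair a a') {b b' : A.carrier} (hb : A.IsInvariantPair b b') :
    A.counit (b * a) = A.T (A.antipode b) (A.counit a) := by
  apply A.ι_injective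
  rw [← (h.mul hb).mul_antipode_self, hb.ι_T_antipode, ← h.mul_antipode_self, A.antipode_mul]
  simp only [mul_assoc]

end IsInvariantPair

end Algebra

end HopfAlgebroid

namespace SmoothCc

/-! ### Bump functions, characters and smoothness tests for `C_c^∞(M)`. -/

section Smooth

variable {𝕜 : Type*} [RCLike 𝕜] {E : Type*} [NormedAddCommGroup E] [NormedSpace ℝ E]
  {M : Type u} [TopologicalSpace M] [ChartedSpace E M]

theorem mul_val (f g : SmoothCc 𝕜 E M) (x : M) : (f * g).1 x = f.1 x * g.1 x := rfl

theorem continuous_val (f : SmoothCc 𝕜 E M) : Continuous f.1 := f.2.1.continuous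

theorem mem_supportedIn {f : SmoothCc 𝕜 E M} {W : Opens M} {x : M} (hf : f ∈ supportedIn W)
    (hx : f.1 x ≠ 0) : x ∈ W :=
  hf (subset_tsupport _ hx)

theorem GermOne.eq_one {f : SmoothCc 𝕜 E M} {x : M} (h : GermOne f x) : f.1 x = 1 :=
  h.self_of_nhds

theorem GermOne.mul {f g : SmoothCc 𝕜 E M} {x : M} (hf : GermOne f x) (hg : GermOne g x) :
    GermOne (f * g) x := by
  filter_upwards [hf, hg] with y h₁ h₂
  rw [mul_val, h₁, h₂, one_mul]

theorem contMDiffAt_mul {N : Type*} [TopologicalSpace N] [ChartedSpace E N] {f g : N → 𝕜} {x : N}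
    (hf : ContMDiffAt 𝓘(ℝ, E) 𝓘(ℝ, 𝕜) ∞ f x) (hg : ContMDiffAt 𝓘(ℝ, E) 𝓘(ℝ, 𝕜) ∞ g x) :
    ContMDiffAt 𝓘(ℝ, E) 𝓘(ℝ, 𝕜) ∞ (fun y => f y * g y) x :=
  (contDiff_mul (𝕜 := ℝ) (𝔸 := 𝕜)).contMDiff.contMDiffAt.comp x (hf.prodMk_space hg)

variable [FiniteDimensional ℝ E] [T2Space M] [IsManifold 𝓘(ℝ, E) ∞ M]

variable (𝕜 E) in
theorem exists_germOne_supportedIn {x : M} {W : Opens M} (hx : x ∈ W) :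
    ∃ f : SmoothCc 𝕜 E M, GermOne f x ∧ f ∈ supportedIn W := by
  have : LocallyCompactSpace M := Manifold.locallyCompact_of_finiteDimensional 𝓘(ℝ, E)
  obtain ⟨t, ht, htc, htW⟩ := exists_mem_nhds_isClosed_subset (W.isOpen.mem_nhds hx)
  obtain ⟨f, hf, hft⟩ := exists_germOne (𝕜 := 𝕜) (E := E) ht
  exact ⟨f, hf, (closure_minimal hft htc).trans htW⟩

variable (𝕜 E) in
theorem eq_of_forall_eq {x y : M} {W : Opens M} (hx : x ∈ W)
    (h : ∀ f ∈ supportedIn (𝕜 := 𝕜) (E := E) W, f.1 x = f.1 y) : x = y := by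
  by_contra hxy
  have hx' : x ∈ W ⊓ ⟨{y}ᶜ, isOpen_compl_singleton⟩ := ⟨hx, hxy⟩
  obtain ⟨f, hf, hfs⟩ := exists_germOne_supportedIn 𝕜 E hx'
  have hy : f.1 y = 0 := by
    by_contra hy
    exact (mem_supportedIn hfs hy).2 rfl
  have := h f fun z hz => (hfs hz).1
  rw [hf.eq_one, hy] at this
  exact one_ne_zero this

/-- A cutoff supported in `U` makes the product smooth everywhere, since smoothness need only be
tested on the support. -/
theorem exists_smul_function {x : M} {U : Set M} (hU : U ∈ 𝓝 x) {g : M → 𝕜}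
    (hg : ∀ y ∈ U, ContMDiffAt 𝓘(ℝ, E) 𝓘(ℝ, 𝕜) ∞ g y) :
    ∃ f : SmoothCc 𝕜 E M, ∀ᶠ y in 𝓝 x, f.1 y = g y := by
  obtain ⟨V, hVU, hV, hxV⟩ := mem_nhds_iff.1 hU
  obtain ⟨q, hq, hqV⟩ := exists_germOne_supportedIn 𝕜 E (W := ⟨V, hV⟩) hxV
  refine ⟨⟨fun y => q.1 y * g y, contMDiff_of_tsupport fun y hy => ?_, q.2.2.mul_right⟩, ?_⟩
  · exact contMDiffAt_mul q.2.1.contMDiffAt (hg y (hVU (hqV (tsupport_mul_subset_left hy))))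
  · filter_upwards [hq] with y hy
    rw [hy, one_mul]

theorem exists_eventually_mul_eq_one (f : SmoothCc 𝕜 E M) {x : M} (hx : f.1 x ≠ 0) :
    ∃ g : SmoothCc 𝕜 E M, GermOne (f * g) x := by
  have hU : {y | f.1 y ≠ 0} ∈ 𝓝 x := (continuous_val f).continuousAt.eventually_ne hx
  obtain ⟨g, hg⟩ := exists_smul_function (𝕜 := 𝕜) (E := E) hU (g := fun y => (f.1 y)⁻¹)
    fun y hy => (contDiffAt_inv ℝ (𝕜' := 𝕜) hy).contMDiffAt.comp y f.2.1.contMDiffAt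
  refine ⟨g, ?_⟩
  filter_upwards [hg, hU] with y hy hy'
  rw [mul_val, hy, mul_inv_cancel₀ hy']

/-- A nonzero character of the algebra of compactly supported smooth functions is the evaluation
at a point. -/
theorem exists_eq_eval (χ : SmoothCc 𝕜 E M →ₗ[𝕜] 𝕜) (hmul : ∀ f g, χ (f * g) = χ f * χ g)
    (h : SmoothCc 𝕜 E M) (h0 : χ h ≠ 0) : ∃ x, ∀ f, χ f = f.1 x := by
  -- The kernel of `χ` has a common zero. Otherwise it contains, near each point, a function equal
  -- to `1`; compactness of the support of `h` yields a kernel element `e` with `h = h e`,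
  -- contradicting `χ h ≠ 0`.
  obtain ⟨x, hx⟩ : ∃ x, ∀ f, χ f = 0 → f.1 x = 0 := by
    by_contra! hne
    suffices ∃ e : SmoothCc 𝕜 E M, χ e = 0 ∧ ∀ y ∈ tsupport h.1, e.1 y = 1 by
      obtain ⟨e, he, he1⟩ := this
      apply h0
      have : h = h * e := by
        ext y
        rw [mul_val]
        by_cases hy : y ∈ tsupport h.1
        · rw [he1 y hy, mul_one]
        · rw [image_eq_zero_of_notMem_tsupport hy, zero_mul]
      rw [this, hmul, he, mul_zero]
    refine IsCompact.induction_on (p := fun s => ∃ e : SmoothCc 𝕜 E M, χ e = 0 ∧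
      ∀ y ∈ s, e.1 y = 1) h.2.2 ⟨0, map_zero _, by simp⟩ ?_ ?_ ?_
    · rintro s t hst ⟨e, he, he1⟩
      exact ⟨e, he, fun y hy => he1 y (hst hy)⟩
    · rintro s t ⟨e, he, he1⟩ ⟨e', he', he1'⟩
      -- This is `1 - (1 - e)(1 - e')`, which equals `1` wherever `e` or `e'` does and stays in the
      -- kernel.
      refine ⟨e + e' - e * e', by rw [map_sub, map_add, hmul, he, he']; simp, ?_⟩
      intro y hy
      change e.1 y + e'.1 y - e.1 y * e'.1 y = 1
      rcases hy with hy | hy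
      · rw [he1 y hy]; ring
      · rw [he1' y hy]; ring
    · intro y _
      obtain ⟨f, hf, hfy⟩ := hne y
      obtain ⟨g, hg⟩ := exists_eventually_mul_eq_one f hfy
      exact ⟨_, mem_nhdsWithin_of_mem_nhds hg, f * g, by rw [hmul, hf, zero_mul], fun _ hz => hz⟩
  -- Evaluation at `x` vanishes on the kernel of `χ`, so it is a multiple of `χ`. Comparing `e` and
  -- `e * e` for a function `e` with `e x = 1` shows that the constant is `1`.
  have key : ∀ f, f.1 x = χ f * ((χ h)⁻¹ * h.1 x) := by
    intro f
    have h₁ : χ (f - (χ f * (χ h)⁻¹) • h) = 0 := by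
      rw [map_sub, map_smul, smul_eq_mul, mul_assoc, inv_mul_cancel₀ h0, mul_one, sub_self]
    have h₂ : f.1 x - (χ f * (χ h)⁻¹) * h.1 x = 0 := hx _ h₁
    rw [← mul_assoc]
    exact sub_eq_zero.1 h₂
  obtain ⟨e, he, -⟩ := exists_germOne (𝕜 := 𝕜) (E := E) (x := x) univ_mem
  generalize (χ h)⁻¹ * h.1 x = c at key
  have h₁ : 1 = χ e * c := by rw [← key, he.eq_one]
  have h₂ : 1 = χ e * χ e * c := by
    rw [← hmul, ← key, mul_val, he.eq_one, one_mul]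
  have h₃ : χ e = 1 := by
    calc χ e = χ e * (χ e * c) := by rw [← h₁, mul_one]
      _ = 1 := by rw [← mul_assoc, ← h₂]
  have hc : c = 1 := by rw [h₃, one_mul] at h₁; exact h₁.symm
  exact ⟨x, fun f => by rw [key, hc, mul_one]⟩

/-- A map is smooth if its compositions with all compactly supported smooth functions are. -/
theorem contMDiffAt_of_forall {N : Type*} [TopologicalSpace N] [ChartedSpace E N] {φ : N → M}
    {x : N} (h : ∀ f : SmoothCc 𝕜 E M, ContMDiffAt 𝓘(ℝ, E) 𝓘(ℝ, 𝕜) ∞ (fun y => f.1 (φ y)) x) :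
    ContMDiffAt 𝓘(ℝ, E) 𝓘(ℝ, E) ∞ φ x := by
  have hcont : ContinuousAt φ x := by
    intro U hU
    obtain ⟨f, hf, hfU⟩ := exists_germOne (𝕜 := 𝕜) (E := E) hU
    have : ∀ᶠ y in 𝓝 x, f.1 (φ y) ≠ 0 :=
      (h f).continuousAt.eventually_ne (by rw [hf.eq_one]; exact one_ne_zero)
    exact this.mono fun y hy => hfU _ hy
  refine contMDiffAt_iff_target.2 ⟨hcont, ?_⟩
  -- Each coordinate of a chart at `φ x` agrees near that point with a test function; the real part
  -- then recovers the real coordinate from its `𝕜`-valued version.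
  let L := (Module.finBasis ℝ E).equivFunL
  suffices H : ContMDiffAt 𝓘(ℝ, E) 𝓘(ℝ, Fin (Module.finrank ℝ E) → ℝ) ∞
      (fun y => L (extChartAt 𝓘(ℝ, E) (φ x) (φ y))) x by
    have := (L.symm.contDiff (n := ∞)).contMDiff.contMDiffAt.comp x H
    refine this.congr_of_eventuallyEq (Eventually.of_forall fun y => ?_)
    simp
  refine contMDiffAt_pi_space.2 fun i => ?_
  obtain ⟨f, hf⟩ := exists_smul_function (𝕜 := 𝕜) (E := E)
    (extChartAt_source_mem_nhds (I := 𝓘(ℝ, E)) (φ x))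
    (g := fun y => ((L (extChartAt 𝓘(ℝ, E) (φ x) y) i : ℝ) : 𝕜)) (by
      intro y hy
      have h₁ : ContDiff ℝ ∞ fun v : E => ((L v i : ℝ) : 𝕜) :=
        (RCLike.ofRealCLM (K := 𝕜)).contDiff.comp
          (((ContinuousLinearMap.proj (R := ℝ) (φ := fun _ => ℝ) i).contDiff).comp L.contDiff)
      exact h₁.contMDiff.contMDiffAt.comp y (contMDiffAt_extChartAt' (by simpa using hy)))
  have h₂ := (RCLike.reCLM (K := 𝕜)).contDiff (n := ∞) |>.contMDiff.contMDiffAt.comp x (h f)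
  refine h₂.congr_of_eventuallyEq ?_
  filter_upwards [hcont.eventually hf] with y hy
  simp [hy]

end Smooth

end SmoothCc

/-! ### Local diffeomorphisms, pulled back smooth structures and fibred products. -/

section LocalDiffeomorphisms

variable {E : Type*} [NormedAddCommGroup E] [NormedSpace ℝ E]
  {X : Type*} [TopologicalSpace X] {Y : Type*} [TopologicalSpace Y]
  {Z : Type*} [TopologicalSpace Z]

/-- The restriction of a partial diffeomorphism to an open set. -/
def PartialDiffeomorph.restrictOpen [ChartedSpace E X] [ChartedSpace E Y]
    (Φ : PartialDiffeomorph 𝓘(ℝ, E) 𝓘(ℝ, E) X Y ∞) (U : Set X) (hU : IsOpen U) :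
    PartialDiffeomorph 𝓘(ℝ, E) 𝓘(ℝ, E) X Y ∞ where
  __ := Φ.toOpenPartialHomeomorph.restrOpen U hU
  contMDiffOn_toFun := Φ.contMDiffOn_toFun.mono Set.inter_subset_left
  contMDiffOn_invFun := Φ.contMDiffOn_invFun.mono Set.inter_subset_left

theorem IsLocalDiffeomorphAt.congr_of_eventuallyEq [ChartedSpace E X] [ChartedSpace E Y]
    {f g : X → Y} {x : X} (hf : IsLocalDiffeomorphAt 𝓘(ℝ, E) 𝓘(ℝ, E) ∞ f x) (h : g =ᶠ[𝓝 x] f) :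
    IsLocalDiffeomorphAt 𝓘(ℝ, E) 𝓘(ℝ, E) ∞ g x := by
  obtain ⟨Φ, hx, hΦ⟩ := hf
  obtain ⟨U, hU, hUo, hxU⟩ := eventually_nhds_iff.1 h
  exact ⟨Φ.restrictOpen U hUo, ⟨hx, hxU⟩, fun y hy => (hU y hy.2).trans (hΦ hy.1)⟩

/-- A continuous lift of a local diffeomorphism along a local diffeomorphism is a local
diffeomorphism. -/
theorem IsLocalDiffeomorph.of_comp_left [ChartedSpace E X] [ChartedSpace E Y] [ChartedSpace E Z]
    {p : Y → Z} (hp : IsLocalDiffeomorph 𝓘(ℝ, E) 𝓘(ℝ, E) ∞ p) {f : X → Y} (hf : Continuous f)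
    (hpf : IsLocalDiffeomorph 𝓘(ℝ, E) 𝓘(ℝ, E) ∞ fun x => p (f x)) :
    IsLocalDiffeomorph 𝓘(ℝ, E) 𝓘(ℝ, E) ∞ f := by
  intro x
  -- Near `x`, continuity keeps `f` inside the domain where the local inverse of `p` undoes `p`, so
  -- `f` is that inverse composed with `p ∘ f`.
  have h := (hpf x).comp 𝓘(ℝ, E) _ (hp (f x)).localInverse_isLocalDiffeomorphAt
  refine h.congr_of_eventuallyEq ?_
  filter_upwards [hf.continuousAt.eventually (hp (f x)).localInverse_eventuallyEq_left] with y hy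
  exact hy.symm

theorem IsLocalDiffeomorph.comp_fun [ChartedSpace E X] [ChartedSpace E Y] [ChartedSpace E Z]
    {g : Y → Z} (hg : IsLocalDiffeomorph 𝓘(ℝ, E) 𝓘(ℝ, E) ∞ g) {f : X → Y}
    (hf : IsLocalDiffeomorph 𝓘(ℝ, E) 𝓘(ℝ, E) ∞ f) :
    IsLocalDiffeomorph 𝓘(ℝ, E) 𝓘(ℝ, E) ∞ fun x => g (f x) :=
  fun x => (hf x).comp 𝓘(ℝ, E) _ (hg (f x))

theorem isLocalDiffeomorph_id [ChartedSpace E X] :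
    IsLocalDiffeomorph 𝓘(ℝ, E) 𝓘(ℝ, E) ∞ fun x : X => x :=
  (Diffeomorph.refl 𝓘(ℝ, E) X ∞).isLocalDiffeomorph

theorem isLocalDiffeomorphAt_chartAt [ChartedSpace E X] [IsManifold 𝓘(ℝ, E) ∞ X] (x : X) :
    IsLocalDiffeomorphAt 𝓘(ℝ, E) 𝓘(ℝ, E) ∞ (chartAt E x) x :=
  ⟨{ toPartialEquiv := (chartAt E x).toPartialEquiv
     open_source := (chartAt E x).open_source
     open_target := (chartAt E x).open_target
     contMDiffOn_toFun := contMDiffOn_chart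
     contMDiffOn_invFun := contMDiffOn_chart_symm }, mem_chart_source E x, fun _ _ => rfl⟩

theorem isLocalDiffeomorphAt_chartAt_symm [ChartedSpace E X] [IsManifold 𝓘(ℝ, E) ∞ X] (x : X) :
    IsLocalDiffeomorphAt 𝓘(ℝ, E) 𝓘(ℝ, E) ∞ (chartAt E x).symm (chartAt E x x) :=
  ⟨{ toPartialEquiv := (chartAt E x).toPartialEquiv.symm
     open_source := (chartAt E x).open_target
     open_target := (chartAt E x).open_source
     contMDiffOn_toFun := contMDiffOn_chart_symm
     contMDiffOn_invFun := contMDiffOn_chart }, mem_chart_target E x, fun _ _ => rfl⟩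

namespace IsLocalHomeomorph

set_option linter.unusedSectionVars false

variable {p : X → Y} (hp : IsLocalHomeomorph p)

/-- The chart at `x` of the manifold structure pulled back along a local homeomorphism. -/
def pullbackChart [ChartedSpace E Y] (x : X) : OpenPartialHomeomorph X E :=
  (hp x).choose.trans (chartAt E (p x))

theorem pullbackChart_apply [ChartedSpace E Y] (x x' : X) :
    hp.pullbackChart (E := E) x x' = chartAt E (p x) (p x') :=
  congrArg (chartAt E (p x)) (congrFun (hp x).choose_spec.2 x').symm

theorem mem_pullbackChart_source [ChartedSpace E Y] {x x' : X} :
    x' ∈ (hp.pullbackChart (E := E) x).source ↔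
      x' ∈ (hp x).choose.source ∧ p x' ∈ (chartAt E (p x)).source := by
  have h : (hp x).choose x' = p x' := (congrFun (hp x).choose_spec.2 x').symm
  rw [← h]
  rfl

/-- The manifold structure pulled back along a local homeomorphism. -/
@[reducible]
def pullbackChartedSpace [ChartedSpace E Y] : ChartedSpace E X where
  atlas := Set.range hp.pullbackChart
  chartAt := hp.pullbackChart
  mem_chart_source x := by
    exact hp.mem_pullbackChart_source.2 ⟨(hp x).choose_spec.1, mem_chart_source E (p x)⟩
  chart_mem_atlas x := ⟨x, rfl⟩

/-- The local homeomorphism cancels in a change of charts, leaving a restriction of a change of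
charts of `Y`. -/
theorem pullback_isManifold [ChartedSpace E Y] [IsManifold 𝓘(ℝ, E) ∞ Y] :
    letI := hp.pullbackChartedSpace (E := E)
    IsManifold 𝓘(ℝ, E) ∞ X := by
  let := hp.pullbackChartedSpace (E := E)
  refine isManifold_of_contDiffOn 𝓘(ℝ, E) ∞ X ?_
  rintro _ _ ⟨x, rfl⟩ ⟨x', rfl⟩
  have key : ∀ v ∈ (hp.pullbackChart (E := E) x).target,
      p ((hp.pullbackChart (E := E) x).symm v) = (chartAt E (p x)).symm v := by
    intro v hv
    have h₁ := (hp.pullbackChart (E := E) x).right_inv hv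
    have h₂ := (hp.pullbackChart (E := E) x).map_target hv
    rw [mem_pullbackChart_source] at h₂
    rw [pullbackChart_apply] at h₁
    conv_rhs => rw [← h₁]
    exact ((chartAt E (p x)).left_inv h₂.2).symm
  have h : ContMDiffOn 𝓘(ℝ, E) 𝓘(ℝ, E) ∞
      (fun v => chartAt E (p x') ((chartAt E (p x)).symm v))
      ((hp.pullbackChart (E := E) x).symm ≫ₕ hp.pullbackChart (E := E) x').source := by
    refine (contMDiffOn_chart (I := 𝓘(ℝ, E)) (n := ∞) (x := p x')).comp
      ((contMDiffOn_chart_symm (I := 𝓘(ℝ, E)) (n := ∞) (x := p x)).mono ?_) ?_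
    · intro v hv
      have h₂ := (hp.mem_pullbackChart_source (E := E)).1 ((hp.pullbackChart (E := E) x).map_target hv.1)
      have := (chartAt E (p x)).map_source h₂.2
      rwa [← hp.pullbackChart_apply (E := E), (hp.pullbackChart (E := E) x).right_inv hv.1] at this
    · intro v hv
      have h₂ := (hp.mem_pullbackChart_source (E := E)).1 hv.2
      rw [Set.mem_preimage, ← key v hv.1]
      exact h₂.2
  rw [contMDiffOn_iff_contDiffOn] at h
  refine (h.mono fun v hv => hv.1).congr fun v hv => ?_
  change hp.pullbackChart (E := E) x' ((hp.pullbackChart (E := E) x).symm v) = _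
  rw [pullbackChart_apply, key v hv.1.1]

theorem pullback_isLocalDiffeomorph [ChartedSpace E Y] [IsManifold 𝓘(ℝ, E) ∞ Y] :
    letI := hp.pullbackChartedSpace (E := E)
    IsLocalDiffeomorph 𝓘(ℝ, E) 𝓘(ℝ, E) ∞ p := by
  let := hp.pullbackChartedSpace (E := E)
  have := hp.pullback_isManifold (E := E)
  intro x
  have h₁ := isLocalDiffeomorphAt_chartAt (E := E) x
  have h₂ := isLocalDiffeomorphAt_chartAt_symm (E := E) (p x)
  have hx : chartAt E x x = chartAt E (p x) (p x) := hp.pullbackChart_apply x x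
  rw [← hx] at h₂
  refine (h₁.comp 𝓘(ℝ, E) _ h₂).congr_of_eventuallyEq ?_
  filter_upwards [(chartAt E x).open_source.mem_nhds (mem_chart_source E x)] with y hy
  change y ∈ (hp.pullbackChart (E := E) x).source at hy
  rw [mem_pullbackChart_source] at hy
  change _ = (chartAt E (p x)).symm (hp.pullbackChart (E := E) x y)
  rw [pullbackChart_apply]
  exact ((chartAt E (p x)).left_inv hy.2).symm

end IsLocalHomeomorph

/-- The first projection of a fibred product is a local homeomorphism, if the second map is. -/
theorem IsLocalHomeomorph.fst_fibredProduct {s : X → Z} (hs : Continuous s) {t : Y → Z}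
    (ht : IsLocalHomeomorph t) :
    IsLocalHomeomorph fun q : {q : X × Y // s q.1 = t q.2} => q.1.1 := by
  classical
  refine IsLocalHomeomorph.mk _ fun q₀ => ?_
  obtain ⟨e, hq₀, rfl⟩ := ht q₀.1.2
  have hinv : ∀ x ∈ s ⁻¹' e.target, s x = e (e.symm (s x)) := fun x hx => (e.right_inv hx).symm
  -- The local section is `x ↦ (x, t⁻¹ (s x))` for a local inverse of `t`; the value `q₀` off its
  -- domain is irrelevant.
  refine ⟨{ toFun := fun q => q.1.1
            invFun := fun x => if hx : x ∈ s ⁻¹' e.target then ⟨(x, e.symm (s x)), hinv x hx⟩ else q₀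
            source := {q | q.1.2 ∈ e.source}
            target := s ⁻¹' e.target
            map_source' := ?_
            map_target' := ?_
            left_inv' := ?_
            right_inv' := ?_
            open_source := ?_
            open_target := ?_
            continuousOn_toFun := ?_
            continuousOn_invFun := ?_ }, hq₀, fun _ _ => rfl⟩
  · intro q hq
    change s q.1.1 ∈ e.target
    rw [q.2]
    exact e.map_source hq
  · intro x hx
    rw [dif_pos hx]
    exact e.map_target hx
  · intro q hq
    have hx : q.1.1 ∈ s ⁻¹' e.target := by
      change s q.1.1 ∈ e.target
      rw [q.2]
      exact e.map_source hq
    rw [dif_pos hx]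
    refine Subtype.ext (Prod.ext rfl ?_)
    change e.symm (s q.1.1) = q.1.2
    rw [q.2, e.left_inv hq]
  · intro x hx
    rw [dif_pos hx]
  · exact (continuous_fst.comp continuous_subtype_val).continuousOn
  · refine Topology.IsInducing.subtypeVal.continuousOn_iff.2 ?_
    have : ContinuousOn (fun x => (x, e.symm (s x))) (s ⁻¹' e.target) :=
      continuousOn_id.prodMk (e.continuousOn_symm.comp hs.continuousOn fun _ h => h)
    refine this.congr fun x hx => ?_
    simp only [Function.comp_apply]
    rw [dif_pos hx]
  · exact e.open_source.preimage (continuous_snd.comp continuous_subtype_val)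
  · exact e.open_target.preimage hs

end LocalDiffeomorphisms

namespace HopfAlgebroid

open SmoothCc

set_option linter.unusedSectionVars false

/-! ### Germs, sources of arrows and the induced diffeomorphisms. -/

section Source

variable {𝕜 : Type*} [RCLike 𝕜] {E : Type*} [NormedAddCommGroup E] [NormedSpace ℝ E]
  [FiniteDimensional ℝ E] {M : Type u} [TopologicalSpace M] [T2Space M] [ChartedSpace E M]
  [IsManifold 𝓘(ℝ, E) ∞ M]
  {A : HopfAlgebroid.{v} 𝕜 (SmoothCc 𝕜 E M)} {a a' b b' c c' : A.carrier} {x y z : M}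

/-! ### Germs -/

theorem germ_eq_iff : A.germ x a = A.germ x b ↔
    ∃ q : SmoothCc 𝕜 E M, GermOne q x ∧ A.ι q * a = A.ι q * b := by
  rw [← sub_eq_zero, ← map_sub, germ, Submodule.mkQ_apply, Submodule.Quotient.mk_eq_zero]
  refine exists_congr fun q => and_congr_right fun _ => ?_
  rw [mul_sub, sub_eq_zero]

theorem germ_ι_mul {f : SmoothCc 𝕜 E M} (hf : GermOne f x) (a : A.carrier) :
    A.germ x (A.ι f * a) = A.germ x a :=
  A.stalkAct_of_germOne hf (A.germ x a)

theorem germ_mul_congr_left (h : A.germ x a = A.germ x b) (c : A.carrier) :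
    A.germ x (a * c) = A.germ x (b * c) := by
  obtain ⟨q, hq, h⟩ := germ_eq_iff.1 h
  exact germ_eq_iff.2 ⟨q, hq, by rw [← mul_assoc, h, mul_assoc]⟩

theorem germ_ι_eq {f g : SmoothCc 𝕜 E M} (hf : GermOne f x) (hg : GermOne g x) :
    A.germ x (A.ι f) = A.germ x (A.ι g) := by
  rw [← germ_ι_mul hg, ← map_mul, mul_comm, map_mul, germ_ι_mul hf]

theorem normalizedAt_congr (h : A.germ x a = A.germ x b) (ha : A.NormalizedAt a x) :
    A.NormalizedAt b x := by
  obtain ⟨q, hq, h⟩ := germ_eq_iff.1 h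
  have h₁ : q * A.counit a = q * A.counit b := by rw [← A.counit_left, h, A.counit_left]
  filter_upwards [hq, ha] with y h₂ h₃
  have := congrArg (fun f : SmoothCc 𝕜 E M => f.1 y) h₁
  simp only [mul_val, h₂, h₃, one_mul] at this
  exact this.symm

theorem eventually_germ_eq (h : A.germ x a = A.germ x b) :
    ∀ᶠ y in 𝓝 x, A.germ y a = A.germ y b := by
  obtain ⟨q, hq, h⟩ := germ_eq_iff.1 h
  filter_upwards [eventually_eventually_nhds.2 hq] with y hy
  exact germ_eq_iff.2 ⟨q, hy, h⟩

theorem NormalizedAt.eventually (h : A.NormalizedAt a x) : ∀ᶠ y in 𝓝 x, A.NormalizedAt a y :=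
  eventually_eventually_nhds.2 h

variable (A) in
/-- The largest open set on which `a` is normalized. -/
def normalizedOpens (a : A.carrier) : Opens M :=
  ⟨{y | A.NormalizedAt a y}, isOpen_iff_mem_nhds.2 fun _ h => NormalizedAt.eventually h⟩

theorem normalizedOn_normalizedOpens (a : A.carrier) : A.NormalizedOn a (A.normalizedOpens a) :=
  fun _ h => h

theorem NormalizedOn.mul_counit {W : Opens M} (h : A.NormalizedOn a W) {f : SmoothCc 𝕜 E M}
    (hf : f ∈ supportedIn W) : f * A.counit a = f := by
  ext y
  rw [mul_val]
  by_cases hy : f.1 y = 0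
  · rw [hy, zero_mul]
  · rw [(h y (mem_supportedIn hf hy)).eq_one, mul_one]

/-! ### The source of an arrow -/

/-- The function `ε a` equals `1` at `y`, and `ε (a g) (y) = g x` for all `g`; the class of `a` is
then an arrow from `x` to `y`. -/
structure Links (A : HopfAlgebroid.{v} 𝕜 (SmoothCc 𝕜 E M)) (a : A.carrier) (x y : M) : Prop where
  counit_eq : (A.counit a).1 y = 1
  T_antipode_eq : ∀ g, (A.T (A.antipode a) g).1 y = g.1 x

theorem T_antipode_apply (a : A.carrier) (g : SmoothCc 𝕜 E M) :
    A.T (A.antipode a) g = A.counit (a * A.ι g) := by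
  rw [T_apply, A.antipode_mul, A.antipode_antipode, A.antipode_ι]

theorem Links.T_eq (h : A.Links a x y) (ha : A.IsInvariantPair a a') (f : SmoothCc 𝕜 E M) :
    (A.T a f).1 x = f.1 y := by
  rw [← h.T_antipode_eq, ha.T_antipode_T, mul_val, mul_val, h.counit_eq, one_mul, mul_one]

/-- Evaluating `T_a f · ε(S a) = T_a (f ε(a))` at `x`, for `f` equal to `1` near `y`, gives `ε(S
a)(x) = 1`. Reversal of arrows comes from here. -/
theorem Links.antipode (h : A.Links a x y) (ha : A.IsInvariantPair a a') :
    A.Links (A.antipode a) y x := by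
  refine ⟨?_, fun g => by rw [A.antipode_antipode, h.T_eq ha]⟩
  obtain ⟨f, hf, -⟩ := exists_germOne (𝕜 := 𝕜) (E := E) (x := y) univ_mem
  have := congrArg (fun f : SmoothCc 𝕜 E M => f.1 x) (ha.T_mul_counit f)
  simpa only [mul_val, h.T_eq ha, hf.eq_one, h.counit_eq, one_mul] using this

theorem links_antipode_iff (ha : A.IsInvariantPair a a') :
    A.Links (A.antipode a) y x ↔ A.Links a x y := by
  refine ⟨fun h => ?_, fun h => h.antipode ha⟩
  have := h.antipode ha.antipode
  rwa [A.antipode_antipode] at this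

theorem Links.source_unique (h : A.Links a x y) (h' : A.Links a z y) : x = z :=
  eq_of_forall_eq 𝕜 E (W := ⊤) trivial fun f _ => by rw [← h.T_antipode_eq, h'.T_antipode_eq]

theorem Links.target_unique (h : A.Links a x y) (h' : A.Links a x z)
    (ha : A.IsInvariantPair a a') : y = z :=
  (h.antipode ha).source_unique (h'.antipode ha)

theorem IsInvariantPair.exists_links (ha : A.IsInvariantPair a a') (hy : (A.counit a).1 y = 1) :
    ∃ x, A.Links a x y := by
  let χ : SmoothCc 𝕜 E M →ₗ[𝕜] 𝕜 :=
    { toFun := fun g => (A.T (A.antipode a) g).1 y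
      map_add' := fun f g => by rw [map_add]; rfl
      map_smul' := fun r f => by rw [map_smul]; rfl }
  -- The defect `ε(S a)` in the multiplicativity of `T_{S a}` can be pulled out as `ε(a)`, which is
  -- `1` at `y`.
  have h₁ : ∀ f, χ (f * A.counit (A.antipode a)) = χ f := by
    intro f
    have := congrArg (fun f : SmoothCc 𝕜 E M => f.1 y) (ha.antipode.T_mul_counit f)
    simp only [A.antipode_antipode, mul_val, hy, mul_one] at this
    exact this.symm
  have hmul : ∀ f g, χ (f * g) = χ f * χ g := by
    intro f g
    rw [← h₁, mul_assoc, mul_comm g, ← mul_assoc]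
    exact congrArg (fun f : SmoothCc 𝕜 E M => f.1 y) (ha.antipode.T_mul_T f g).symm
  obtain ⟨f, hf, -⟩ := exists_germOne (𝕜 := 𝕜) (E := E) (x := y) univ_mem
  -- The character is nonzero because `T_{S a} (T_a f) = ε(a) f ε(a)` takes the value `1` at `y`.
  have h0 : χ (A.T a f) ≠ 0 := by
    change (A.T (A.antipode a) (A.T a f)).1 y ≠ 0
    rw [ha.T_antipode_T, mul_val, mul_val, hy, hf.eq_one, one_mul, one_mul]
    exact one_ne_zero
  obtain ⟨x, hx⟩ := exists_eq_eval χ hmul _ h0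
  exact ⟨x, hy, hx⟩

/-- Both conditions are values at `y` of `ε` on `a` and on `a g`, and `q a = q b` implies `q a g = q
b g`. Hence the source of an arrow does not depend on its representative. -/
theorem Links.congr (h : A.Links a x y) (hab : A.germ y a = A.germ y b) : A.Links b x y := by
  obtain ⟨q, hq, hab⟩ := germ_eq_iff.1 hab
  have key : ∀ {p r : A.carrier}, A.ι q * p = A.ι q * r → (A.counit p).1 y = (A.counit r).1 y := by
    intro p r hpr
    have h₁ : q * A.counit p = q * A.counit r := by rw [← A.counit_left, hpr, A.counit_left]
    have := congrArg (fun f : SmoothCc 𝕜 E M => f.1 y) h₁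
    simpa only [mul_val, hq.eq_one, one_mul] using this
  refine ⟨(key hab).symm.trans h.counit_eq, fun g => ?_⟩
  rw [← h.T_antipode_eq, T_antipode_apply, T_antipode_apply]
  exact key (by rw [← mul_assoc, ← hab, mul_assoc])

theorem links_ι {f : SmoothCc 𝕜 E M} (hf : f.1 x = 1) : A.Links (A.ι f) x x :=
  ⟨by rw [A.counit_ι, hf], fun g => by rw [A.antipode_ι, T_ι, mul_val, hf, mul_one]⟩

theorem Links.mul (hb : A.Links b y z) (ha : A.Links a x y) (hb' : A.IsInvariantPair b b')
    (ha' : A.IsInvariantPair a a') : A.Links (b * a) x z := by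
  refine ⟨by rw [ha'.counit_mul_eq hb', hb.T_antipode_eq, ha.counit_eq], fun g => ?_⟩
  rw [A.antipode_mul, hb'.antipode.T_mul ha'.antipode, hb.T_antipode_eq, ha.T_antipode_eq]

theorem Links.germOne_T_antipode (h : A.Links a x y) (ha : A.IsInvariantPair a a')
    (hn : A.NormalizedAt a y) {q : SmoothCc 𝕜 E M} (hq : GermOne q x) :
    GermOne (A.T (A.antipode a) q) y := by
  -- The auxiliary bump `r` stands in for continuity of the source map: where `T_{S a} r ≠ 0`, the
  -- source lies in the set on which `q = 1`.
  obtain ⟨r, hr, hrq⟩ := exists_germOne (𝕜 := 𝕜) (E := E) hq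
  have h₁ : ∀ᶠ z in 𝓝 y, (A.T (A.antipode a) r).1 z ≠ 0 :=
    (continuous_val _).continuousAt.eventually_ne (by
      rw [h.T_antipode_eq, hr.eq_one]; exact one_ne_zero)
  filter_upwards [h₁, hn] with z hz hz'
  obtain ⟨w, hw⟩ := ha.exists_links hz'
  rw [hw.T_antipode_eq] at hz ⊢
  exact hrq w hz

theorem Links.germOne_T (h : A.Links a x y) (ha : A.IsInvariantPair a a')
    (hn : A.NormalizedAt (A.antipode a) x) {q : SmoothCc 𝕜 E M} (hq : GermOne q y) :
    GermOne (A.T a q) x := by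
  have := (h.antipode ha).germOne_T_antipode ha.antipode hn hq
  rwa [A.antipode_antipode] at this

theorem Links.normalizedAt_mul (hb : A.Links b y z) (hb' : A.IsInvariantPair b b')
    (ha' : A.IsInvariantPair a a') (hnb : A.NormalizedAt b z) (hna : A.NormalizedAt a y) :
    A.NormalizedAt (b * a) z := by
  rw [NormalizedAt, ha'.counit_mul_eq hb']
  exact hb.germOne_T_antipode hb' hnb hna

/-- Normalization on the support of `f` gives `T_a f · ε(S a) = T_a f`, and the nonzero value can be
cancelled. -/
theorem IsInvariantPair.counit_antipode_eq_one (ha : A.IsInvariantPair a a') {W : Opens M}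
    (hW : A.NormalizedOn a W) {f : SmoothCc 𝕜 E M} (hf : f ∈ supportedIn W)
    (hx : (A.T a f).1 x ≠ 0) : (A.counit (A.antipode a)).1 x = 1 := by
  have := congrArg (fun f : SmoothCc 𝕜 E M => f.1 x) (ha.T_mul_counit f)
  simp only [hW.mul_counit hf, mul_val] at this
  exact mul_left_cancel₀ hx (by rw [this, mul_one])

variable (A) in
/-- The set of sources of the arrows represented by `a` with target in `W`. -/
def sourceOpens (a : A.carrier) (W : Opens M) : Opens M :=
  ⟨{x | ∃ f ∈ supportedIn (𝕜 := 𝕜) (E := E) W, (A.T a f).1 x ≠ 0}, by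
    simp only [Set.ofPred_exists, Set.ofPred_and]
    refine isOpen_iUnion fun f => isOpen_const.inter ?_
    exact isOpen_ne_fun (continuous_val _) continuous_const⟩

/-- Reconciles the two descriptions of the set of sources: nonvanishing of some `T_a f` makes
openness evident, while links identify the points. -/
theorem mem_sourceOpens_iff (ha : A.IsInvariantPair a a') {W : Opens M}
    (hW : A.NormalizedOn a W) : x ∈ A.sourceOpens a W ↔ ∃ y ∈ W, A.Links a x y := by
  constructor
  · rintro ⟨f, hf, hx⟩
    obtain ⟨y, hy⟩ := ha.antipode.exists_links (ha.counit_antipode_eq_one hW hf hx)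
    rw [links_antipode_iff ha] at hy
    rw [hy.T_eq ha] at hx
    exact ⟨y, mem_supportedIn hf hx, hy⟩
  · rintro ⟨y, hy, h⟩
    obtain ⟨f, hf, hfW⟩ := exists_germOne_supportedIn 𝕜 E hy
    exact ⟨f, hfW, by rw [h.T_eq ha, hf.eq_one]; exact one_ne_zero⟩

theorem normalizedOn_sourceOpens (ha : A.IsInvariantPair a a') {W : Opens M}
    (hW : A.NormalizedOn a W) : A.NormalizedOn (A.antipode a) (A.sourceOpens a W) := by
  intro x hx
  filter_upwards [(A.sourceOpens a W).isOpen.mem_nhds hx] with z hz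
  obtain ⟨f, hf, hz⟩ := hz
  exact ha.counit_antipode_eq_one hW hf hz

theorem Links.normalizedAt_antipode (h : A.Links a x y) (ha : A.IsInvariantPair a a')
    (hn : A.NormalizedAt a y) : A.NormalizedAt (A.antipode a) x :=
  normalizedOn_sourceOpens ha (normalizedOn_normalizedOpens a) x
    ((mem_sourceOpens_iff ha (normalizedOn_normalizedOpens a)).2 ⟨y, hn, h⟩)

/-- The cutoff `q` witnessing equality of germs at `y` is carried through `b` by the commutation
rule, becoming the cutoff `T_{S b} q` at `z`. This makes the product of arrows well defined in its
right factor. -/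
theorem Links.germ_mul_congr_right (hb : A.Links b y z) (hb' : A.IsInvariantPair b b')
    (hn : A.NormalizedAt b z) (h : A.germ y a = A.germ y c) :
    A.germ z (b * a) = A.germ z (b * c) := by
  obtain ⟨q, hq, h⟩ := germ_eq_iff.1 h
  refine germ_eq_iff.2 ⟨_, hb.germOne_T_antipode hb' hn hq, ?_⟩
  rw [← mul_assoc, hb'.T_antipode_mul, mul_assoc, h, ← mul_assoc, ← hb'.T_antipode_mul, mul_assoc]

theorem Links.germ_mul_ι (h : A.Links a x y) (ha : A.IsInvariantPair a a')
    (hn : A.NormalizedAt a y) {q : SmoothCc 𝕜 E M} (hq : GermOne q x) :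
    A.germ y (a * A.ι q) = A.germ y a := by
  rw [← germ_ι_mul hn, ← mul_assoc, ← ha.T_antipode_mul,
    germ_ι_mul (h.germOne_T_antipode ha hn hq)]

/-- As `S(q a) = S(a) q`, the commutation rule for `S a` turns the cutoff at `y` into `T_a q`, which
is `1` near `x`. Cutting off at the target thus leaves the germ of the inverse unchanged. -/
theorem Links.germ_antipode_eq (h : A.Links a x y) (ha : A.IsInvariantPair a a')
    (hn : A.NormalizedAt a y) {q : SmoothCc 𝕜 E M} (hq : GermOne q y) :
    A.germ x (A.antipode a) = A.germ x (A.antipode (A.ι q * a)) := by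
  have hn' := h.normalizedAt_antipode ha hn
  have h₁ := ha.antipode.T_antipode_mul q
  rw [A.antipode_antipode, mul_assoc] at h₁
  rw [← germ_ι_mul (h.germOne_T ha hn' hq), h₁, germ_ι_mul hn', A.antipode_mul, A.antipode_ι]

theorem Links.germ_antipode_congr (h : A.Links a x y) (ha : A.IsInvariantPair a a')
    (hn : A.NormalizedAt a y) (hc : A.IsInvariantPair c c') (hac : A.germ y a = A.germ y c) :
    A.germ x (A.antipode a) = A.germ x (A.antipode c) := by
  have hnc := normalizedAt_congr hac hn
  have hlc := h.congr hac
  obtain ⟨q, hq, hac⟩ := germ_eq_iff.1 hac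
  rw [h.germ_antipode_eq ha hn hq, hlc.germ_antipode_eq hc hnc hq, hac]

/-! ### The diffeomorphisms induced by invariant weakly grouplike elements -/

open Classical in
variable (A) in
/-- The source of the arrow represented by `a` with target `y`. -/
def sourceMap (a : A.carrier) (y : M) : M := if h : ∃ x, A.Links a x y then h.choose else y

theorem Links.sourceMap_eq (h : A.Links a x y) : A.sourceMap a y = x := by
  have h' : ∃ x, A.Links a x y := ⟨x, h⟩
  rw [sourceMap, dif_pos h']
  exact h'.choose_spec.source_unique h

theorem IsInvariantPair.links_sourceMap (ha : A.IsInvariantPair a a')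
    (hy : (A.counit a).1 y = 1) : A.Links a (A.sourceMap a y) y := by
  obtain ⟨x, hx⟩ := ha.exists_links hy
  rwa [hx.sourceMap_eq]

theorem IsInvariantPair.contMDiffOn_sourceMap (ha : A.IsInvariantPair a a') {W : Opens M}
    (hW : A.NormalizedOn a W) : ContMDiffOn 𝓘(ℝ, E) 𝓘(ℝ, E) ∞ (A.sourceMap a) W := by
  intro y hy
  refine (contMDiffAt_of_forall (𝕜 := 𝕜) fun f => ?_).contMDiffWithinAt
  refine (A.T (A.antipode a) f).2.1.contMDiffAt.congr_of_eventuallyEq ?_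
  filter_upwards [W.isOpen.mem_nhds hy] with z hz
  exact ((ha.links_sourceMap (hW z hz).eq_one).T_antipode_eq f).symm

/-- The partial diffeomorphism from the targets to the sources of the arrows represented
by `a`. -/
def IsInvariantPair.sourcePartialDiffeomorph (ha : A.IsInvariantPair a a') {W : Opens M}
    (hW : A.NormalizedOn a W) : PartialDiffeomorph 𝓘(ℝ, E) 𝓘(ℝ, E) M M ∞ where
  toFun := A.sourceMap a
  invFun := A.sourceMap (A.antipode a)
  source := W
  target := A.sourceOpens a W
  map_source' y hy :=
    (mem_sourceOpens_iff ha hW).2 ⟨y, hy, ha.links_sourceMap (hW y hy).eq_one⟩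
  map_target' x hx := by
    obtain ⟨y, hy, h⟩ := (mem_sourceOpens_iff ha hW).1 hx
    rwa [(h.antipode ha).sourceMap_eq]
  left_inv' y hy := ((ha.links_sourceMap (hW y hy).eq_one).antipode ha).sourceMap_eq
  right_inv' x hx := by
    obtain ⟨y, hy, h⟩ := (mem_sourceOpens_iff ha hW).1 hx
    rw [(h.antipode ha).sourceMap_eq, h.sourceMap_eq]
  open_source := W.isOpen
  open_target := (A.sourceOpens a W).isOpen
  contMDiffOn_toFun := ha.contMDiffOn_sourceMap hW
  contMDiffOn_invFun := ha.antipode.contMDiffOn_sourceMap (normalizedOn_sourceOpens ha hW)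

/-- The diffeomorphism between the open sets of sources and of targets of the arrows represented
by `a`. -/
def IsInvariantPair.diffeomorph (ha : A.IsInvariantPair a a') {W : Opens M}
    (hW : A.NormalizedOn a W) :
    Diffeomorph 𝓘(ℝ, E) 𝓘(ℝ, E) (A.sourceOpens a W) W ∞ where
  toFun x := ⟨A.sourceMap (A.antipode a) x,
    (ha.sourcePartialDiffeomorph hW).map_target' x.2⟩
  invFun y := ⟨A.sourceMap a y, (ha.sourcePartialDiffeomorph hW).map_source' y.2⟩
  left_inv x := Subtype.ext ((ha.sourcePartialDiffeomorph hW).right_inv' x.2)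
  right_inv y := Subtype.ext ((ha.sourcePartialDiffeomorph hW).left_inv' y.2)
  contMDiff_toFun := (ContMDiff.subtypeVal_comp_iff _ _).1
    ((ha.sourcePartialDiffeomorph hW).contMDiffOn_invFun.comp_contMDiff contMDiff_subtype_val
      fun x => x.2)
  contMDiff_invFun := (ContMDiff.subtypeVal_comp_iff _ _).1
    ((ha.sourcePartialDiffeomorph hW).contMDiffOn_toFun.comp_contMDiff contMDiff_subtype_val
      fun x => x.2)

theorem IsInvariantPair.links_diffeomorph (ha : A.IsInvariantPair a a') {W : Opens M}
    (hW : A.NormalizedOn a W) (x : A.sourceOpens a W) : A.Links a x (ha.diffeomorph hW x) := by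
  obtain ⟨y, hy, h⟩ := (mem_sourceOpens_iff ha hW).1 x.2
  have : (ha.diffeomorph hW x : M) = y := (h.antipode ha).sourceMap_eq
  rwa [this]

theorem T_mem_supportedIn (ha : A.IsInvariantPair a a') {W : Opens M} (hW : A.NormalizedOn a W)
    {f : SmoothCc 𝕜 E M} (hf : f ∈ supportedIn W) :
    A.T a f ∈ supportedIn (A.sourceOpens a W) := by
  -- The source map carries the compact support of `f` to a compact, hence closed, subset of the
  -- Hausdorff space `M`, which traps the support of `T_a f`.
  have hK : IsCompact (A.sourceMap a '' tsupport f.1) :=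
    f.2.2.image_of_continuousOn ((ha.contMDiffOn_sourceMap hW).continuousOn.mono hf)
  have hsub : tsupport (A.T a f).1 ⊆ A.sourceMap a '' tsupport f.1 := by
    refine closure_minimal (fun x hx => ?_) hK.isClosed
    obtain ⟨y, -, h⟩ := (mem_sourceOpens_iff ha hW).1 ⟨f, hf, hx⟩
    refine ⟨y, subset_tsupport _ ?_, h.sourceMap_eq⟩
    rwa [Function.mem_support, ← h.T_eq ha]
  refine hsub.trans ?_
  rintro _ ⟨y, hy, rfl⟩
  exact (ha.sourcePartialDiffeomorph hW).map_source' (hf hy)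

theorem sourceOpens_sourceOpens (ha : A.IsInvariantPair a a') {W : Opens M}
    (hW : A.NormalizedOn a W) : A.sourceOpens (A.antipode a) (A.sourceOpens a W) = W := by
  ext y
  change y ∈ A.sourceOpens (A.antipode a) (A.sourceOpens a W) ↔ y ∈ W
  rw [mem_sourceOpens_iff ha.antipode (normalizedOn_sourceOpens ha hW)]
  constructor
  · rintro ⟨x, hx, h⟩
    obtain ⟨z, hz, h'⟩ := (mem_sourceOpens_iff ha hW).1 hx
    rwa [((links_antipode_iff ha).1 h).target_unique h' ha]
  · intro hy
    have h := ha.links_sourceMap (hW y hy).eq_one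
    exact ⟨_, (mem_sourceOpens_iff ha hW).2 ⟨y, hy, h⟩, h.antipode ha⟩

theorem IsInvariantPair.isInduced (ha : A.IsInvariantPair a a') {W : Opens M}
    (hW : A.NormalizedOn a W) :
    A.IsInduced a W (A.sourceOpens a W) (ha.diffeomorph hW) := by
  refine ⟨Set.Subset.antisymm ?_ fun g hg => ?_, fun f _ x => (ha.links_diffeomorph hW x).T_eq ha f⟩
  · rintro _ ⟨f, hf, rfl⟩
    exact T_mem_supportedIn ha hW hf
  · have hV := normalizedOn_sourceOpens ha hW
    -- The preimage of `g` is `T_{S a} g`: applying `T_a` gives `ε(S a) g ε(S a)`, and `ε(S a) = 1`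
    -- on the support of `g`.
    refine ⟨A.T (A.antipode a) g, ?_, ?_⟩
    · have := T_mem_supportedIn ha.antipode hV hg
      rwa [sourceOpens_sourceOpens ha hW] at this
    · rw [ha.T_T_antipode, mul_comm _ g, hV.mul_counit hg, hV.mul_counit hg]

/-- Any `τ` inducing `T_a` has its values forced by the links, because test functions on `W`
separate the true target from every other point. Both uniqueness and the source formula rest on
this. -/
theorem IsInduced.links (ha : A.IsInvariantPair a a') {W V : Opens M} (hW : A.NormalizedOn a W)
    {τ : Diffeomorph 𝓘(ℝ, E) 𝓘(ℝ, E) V W ∞} (h : A.IsInduced a W V τ) (x : V) :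
    A.Links a x (τ x) := by
  obtain ⟨f, hf, hfW⟩ := exists_germOne_supportedIn 𝕜 E (τ x).2
  have hx : (x : M) ∈ A.sourceOpens a W :=
    ⟨f, hfW, by rw [h.apply_eq f hfW, hf.eq_one]; exact one_ne_zero⟩
  obtain ⟨y, hy, hl⟩ := (mem_sourceOpens_iff ha hW).1 hx
  have : y = τ x := eq_of_forall_eq 𝕜 E hy fun g hg => by
    rw [← hl.T_eq ha, h.apply_eq g hg]
  rwa [← this]

theorem supportedIn_injective {V W : Opens M}
    (h : supportedIn (𝕜 := 𝕜) (E := E) V = supportedIn W) : V = W := by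
  have key : ∀ {V W : Opens M}, supportedIn (𝕜 := 𝕜) (E := E) V ⊆ supportedIn W → V ≤ W := by
    intro V W h x hx
    obtain ⟨f, hf, hfV⟩ := exists_germOne_supportedIn 𝕜 E hx
    exact mem_supportedIn (h hfV) (by rw [hf.eq_one]; exact one_ne_zero)
  exact le_antisymm (key h.subset) (key h.superset)

theorem existsUnique_isInduced (ha : a ∈ A.invariantWeaklyGrouplike) {W : Opens M}
    (hW : A.NormalizedOn a W) :
    ∃! p : (V : Opens M) × Diffeomorph 𝓘(ℝ, E) 𝓘(ℝ, E) V W ∞, A.IsInduced a W p.1 p.2 := by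
  obtain ⟨a', ha⟩ := mem_invariantWeaklyGrouplike.1 ha
  refine ⟨⟨_, ha.diffeomorph hW⟩, ha.isInduced hW, ?_⟩
  rintro ⟨V, τ⟩ h
  have h₀ := ha.isInduced hW
  have hV : V = A.sourceOpens a W := supportedIn_injective (h.image_eq.symm.trans h₀.image_eq)
  subst hV
  congr 1
  refine Diffeomorph.ext fun x => Subtype.ext ?_
  exact (h.links ha hW x).target_unique (ha.links_diffeomorph hW x) ha

end Source

end HopfAlgebroid

namespace HopfAlgebroid

open SmoothCc

/-! ### The étale groupoid of arrows and its functoriality. -/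

section Arrows

set_option linter.unusedSectionVars false

variable {𝕜 : Type*} [RCLike 𝕜] {E : Type*} [NormedAddCommGroup E] [NormedSpace ℝ E]
  [FiniteDimensional ℝ E] {M : Type u} [TopologicalSpace M] [T2Space M] [ChartedSpace E M]
  [IsManifold 𝓘(ℝ, E) ∞ M]
  {A : HopfAlgebroid.{v} 𝕜 (SmoothCc 𝕜 E M)} {a b : A.carrier} {x y : M}

/-! ### The topology of the sheaf of arrows -/

theorem germ_mem_grouplike (ha : a ∈ A.weaklyGrouplike) (hn : A.NormalizedAt a y) :
    A.germ y a ∈ A.grouplike y := by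
  obtain ⟨a', ha⟩ := ha
  have h : A.germ y a' = A.germ y a := by
    rw [← germ_ι_mul hn a', counit_ι_mul_of_comul_eq ha]
  constructor
  · change A.germTensor y (A.comul a) = _
    rw [ha]
    change BalancedTensor.tmul (A.stalkAct y) (A.germ y a) (A.germ y a') = _
    rw [h]
  · exact Germ.coe_eq.2 hn

theorem isOpen_basicSet (ha : a ∈ A.weaklyGrouplike) {W : Opens M} (hW : A.NormalizedOn a W) :
    IsOpen (A.basicSet a W) :=
  isOpen_generateFrom_of_mem ⟨a, W, ha, hW, rfl⟩

/-- Equality of germs at a point persists nearby, so the property passes from the generating sets to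
all open sets. No grouplike condition on `a` is required. -/
theorem exists_basicSet_subset {s : Set A.SpectralSheaf} (hs : IsOpen s) {ζ : A.SpectralSheaf}
    (hζ : ζ ∈ s) (ha : ζ.val = A.germ ζ.proj a) :
    ∃ W : Opens M, ζ.proj ∈ W ∧ A.basicSet a W ⊆ s := by
  induction hs with
  | basic s hs =>
    obtain ⟨c, W, -, -, rfl⟩ := hs
    obtain ⟨hζW, hc⟩ := hζ
    obtain ⟨t, ht, hto, hζt⟩ := eventually_nhds_iff.1 (eventually_germ_eq (ha.symm.trans hc))
    refine ⟨W ⊓ ⟨t, hto⟩, ⟨hζW, hζt⟩, ?_⟩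
    rintro ξ ⟨⟨h₁, h₂⟩, h₃⟩
    exact ⟨h₁, h₃.trans (ht _ h₂)⟩
  | univ => exact ⟨⊤, trivial, Set.subset_univ _⟩
  | inter s t _ _ ihs iht =>
    obtain ⟨V, hV, hVs⟩ := ihs hζ.1
    obtain ⟨W, hW, hWt⟩ := iht hζ.2
    exact ⟨V ⊓ W, ⟨hV, hW⟩, fun ξ h => ⟨hVs ⟨h.1.1, h.2⟩, hWt ⟨h.1.2, h.2⟩⟩⟩
  | sUnion S _ ih =>
    obtain ⟨s, hs, hζs⟩ := hζ
    obtain ⟨W, hW, h⟩ := ih s hs hζs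
    exact ⟨W, hW, h.trans (Set.subset_sUnion_of_mem hs)⟩

theorem isOpen_arrows : IsOpen A.arrows := by
  refine isOpen_iff_forall_mem_open.2 ?_
  rintro ζ ⟨a, ha, hn, h⟩
  refine ⟨A.basicSet a (A.normalizedOpens a), fun ξ hξ => ⟨a, ha, hξ.1, hξ.2⟩,
    isOpen_basicSet (invariantWeaklyGrouplike_subset ha) (normalizedOn_normalizedOpens a),
    hn, h⟩

theorem isTopologicalBasis_basicSet :
    IsTopologicalBasis {s : Set A.Gsp | ∃ a ∈ A.invariantWeaklyGrouplike, ∃ W : Opens M,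
      A.NormalizedOn a W ∧ s = Subtype.val ⁻¹' A.basicSet a W} := by
  refine isTopologicalBasis_of_isOpen_of_nhds ?_ ?_
  · rintro _ ⟨a, ha, W, hW, rfl⟩
    exact (isOpen_basicSet (invariantWeaklyGrouplike_subset ha) hW).preimage
      continuous_subtype_val
  · rintro g _ hg ⟨s, hs, rfl⟩
    obtain ⟨a, ha, hn, h⟩ := g.2
    obtain ⟨W, hW, hWs⟩ := exists_basicSet_subset hs hg h
    exact ⟨_, ⟨a, ha, W ⊓ A.normalizedOpens a, fun x hx => hx.2, rfl⟩, ⟨⟨hW, hn⟩, h⟩,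
      fun g' hg' => hWs ⟨hg'.1.1, hg'.2⟩⟩

namespace Gsp

/-- The arrow `a_y`. -/
def ofElement (ha : a ∈ A.invariantWeaklyGrouplike) (hn : A.NormalizedAt a y) : A.Gsp :=
  ⟨⟨y, A.germ y a, germ_mem_grouplike (invariantWeaklyGrouplike_subset ha) hn⟩,
    a, ha, hn, rfl⟩

/-- The target of an arrow. -/
def target (g : A.Gsp) : M := g.1.proj

theorem isRepresentedBy_ofElement (ha : a ∈ A.invariantWeaklyGrouplike)
    (hn : A.NormalizedAt a y) : (ofElement ha hn).IsRepresentedBy a :=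
  ⟨ha, hn, rfl⟩

theorem exists_isRepresentedBy (g : A.Gsp) : ∃ a, g.IsRepresentedBy a := g.2

theorem ext_of_germ_eq {g h : A.Gsp} (hgh : g.target = h.target) (hg : g.IsRepresentedBy a)
    (hh : h.IsRepresentedBy b) (hab : A.germ g.target a = A.germ g.target b) : g = h := by
  obtain ⟨⟨x, ζ, hζ⟩, hg'⟩ := g
  obtain ⟨⟨y, ξ, hξ⟩, hh'⟩ := h
  change x = y at hgh
  subst hgh
  have : ζ = ξ := hg.2.2.trans (hab.trans hh.2.2.symm)
  subst this
  rfl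

theorem ext_of_isRepresentedBy {g h : A.Gsp} (hgh : g.target = h.target)
    (hg : g.IsRepresentedBy a) (hh : h.IsRepresentedBy a) : g = h :=
  ext_of_germ_eq hgh hg hh rfl

theorem IsRepresentedBy.germ_eq {g : A.Gsp} (ha : g.IsRepresentedBy a)
    (hb : g.IsRepresentedBy b) : A.germ g.target a = A.germ g.target b :=
  ha.2.2.symm.trans hb.2.2

theorem IsRepresentedBy.congr {g : A.Gsp} (ha : g.IsRepresentedBy a)
    (hb : b ∈ A.invariantWeaklyGrouplike) (h : A.germ g.target a = A.germ g.target b) :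
    g.IsRepresentedBy b :=
  ⟨hb, normalizedAt_congr h ha.2.1, ha.2.2.trans h⟩

theorem IsRepresentedBy.eventually {g : A.Gsp} (ha : g.IsRepresentedBy a) :
    ∀ᶠ h in 𝓝 g, h.IsRepresentedBy a := by
  have h : IsOpen (Subtype.val ⁻¹' A.basicSet a (A.normalizedOpens a) : Set A.Gsp) :=
    (isOpen_basicSet (invariantWeaklyGrouplike_subset ha.1)
      (normalizedOn_normalizedOpens a)).preimage continuous_subtype_val
  filter_upwards [h.mem_nhds ⟨ha.2.1, ha.2.2⟩] with g' hg'
  exact ⟨ha.1, hg'.1, hg'.2⟩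

theorem continuous_target : Continuous (target : A.Gsp → M) := by
  refine continuous_iff_continuousAt.2 fun g => ?_
  intro U hU
  obtain ⟨V, hVU, hV, hgV⟩ := mem_nhds_iff.1 hU
  obtain ⟨a, ha⟩ := g.exists_isRepresentedBy
  have hW : A.NormalizedOn a (⟨V, hV⟩ ⊓ A.normalizedOpens a) := fun x hx => hx.2
  have h : IsOpen (Subtype.val ⁻¹' A.basicSet a (⟨V, hV⟩ ⊓ A.normalizedOpens a) : Set A.Gsp) :=
    (isOpen_basicSet (invariantWeaklyGrouplike_subset ha.1) hW).preimage continuous_subtype_val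
  exact mem_map.2 (mem_of_superset (h.mem_nhds ⟨⟨hgV, ha.2.1⟩, ha.2.2⟩)
    fun g' hg' => hVU hg'.1.1)

/-- Basic sets of `a` are cut out of the arrows represented by `a` by the target alone, so
continuity reduces to that of the target. Continuity of units, inverses, products and induced maps
follows this way. -/
theorem continuousAt_of_eventually {Z : Type*} [TopologicalSpace Z] {f : Z → A.Gsp} {z : Z}
    (hf : ContinuousAt (fun w => (f w).target) z)
    (h : ∀ᶠ w in 𝓝 z, (f w).IsRepresentedBy a) : ContinuousAt f z := by
  intro u hu
  obtain ⟨_, htu, ⟨s, hs, rfl⟩, hzs⟩ := mem_nhds_iff.1 hu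
  obtain ⟨W, hW, hWs⟩ := exists_basicSet_subset hs hzs h.self_of_nhds.2.2
  have hW' : ∀ᶠ w in 𝓝 z, (f w).target ∈ W := hf.eventually (W.isOpen.mem_nhds hW)
  exact (h.and hW').mono fun w hw => htu (hWs ⟨hw.2, hw.1.2.2⟩)

theorem isLocalHomeomorph_target : IsLocalHomeomorph (target : A.Gsp → M) := by
  classical
  refine IsLocalHomeomorph.mk _ fun g => ?_
  obtain ⟨a, ha⟩ := g.exists_isRepresentedBy
  have hN : ∀ (y : M) (hy : A.NormalizedAt a y),
      (if h : A.NormalizedAt a y then ofElement ha.1 h else g) = ofElement ha.1 hy :=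
    fun y h => dif_pos h
  refine ⟨{ toFun := target
            invFun := fun y => if h : A.NormalizedAt a y then ofElement ha.1 h else g
            source := {g | g.IsRepresentedBy a}
            target := A.normalizedOpens a
            map_source' := fun g hg => hg.2.1
            map_target' := fun y hy => by
              rw [hN y hy]
              exact isRepresentedBy_ofElement ha.1 hy
            left_inv' := fun g hg => by
              rw [hN (target g) hg.2.1]
              exact ext_of_isRepresentedBy rfl (isRepresentedBy_ofElement ha.1 hg.2.1) hg
            right_inv' := fun y hy => by
              rw [hN y hy]
              rfl
            open_source := isOpen_iff_mem_nhds.2 fun g hg => hg.eventually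
            open_target := (A.normalizedOpens a).isOpen
            continuousOn_toFun := continuous_target.continuousOn
            continuousOn_invFun := fun y hy => ContinuousAt.continuousWithinAt ?_ }, ha,
    fun _ _ => rfl⟩
  have hy' : ∀ᶠ z in 𝓝 y, A.NormalizedAt a z := NormalizedAt.eventually hy
  refine continuousAt_of_eventually (a := a) (continuousAt_id.congr ?_) ?_
  · filter_upwards [hy'] with z hz
    rw [hN z hz]
    rfl
  · filter_upwards [hy'] with z hz
    rw [hN z hz]
    exact isRepresentedBy_ofElement ha.1 hz

instance : ChartedSpace E A.Gsp := isLocalHomeomorph_target.pullbackChartedSpace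

instance : IsManifold 𝓘(ℝ, E) ∞ A.Gsp := isLocalHomeomorph_target.pullback_isManifold

theorem isLocalDiffeomorph_target :
    IsLocalDiffeomorph 𝓘(ℝ, E) 𝓘(ℝ, E) ∞ (target : A.Gsp → M) :=
  isLocalHomeomorph_target.pullback_isLocalDiffeomorph

/-! ### The structure maps of the groupoid of arrows -/

/-- The source of an arrow. -/
def source (g : A.Gsp) : M := A.sourceMap g.exists_isRepresentedBy.choose g.target

theorem IsRepresentedBy.links {g : A.Gsp} (ha : g.IsRepresentedBy a) :
    A.Links a g.source g.target := by
  have h := g.exists_isRepresentedBy.choose_spec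
  obtain ⟨c', hc⟩ := mem_invariantWeaklyGrouplike.1 h.1
  exact (hc.links_sourceMap h.2.1.eq_one).congr (h.germ_eq ha)

theorem isLocalDiffeomorph_source :
    IsLocalDiffeomorph 𝓘(ℝ, E) 𝓘(ℝ, E) ∞ (source : A.Gsp → M) := by
  intro g
  obtain ⟨a, ha⟩ := g.exists_isRepresentedBy
  obtain ⟨a', ha'⟩ := mem_invariantWeaklyGrouplike.1 ha.1
  -- On arrows represented by `a`, the source is `sourceMap a` after the target.
  have h := (isLocalDiffeomorph_target g).comp 𝓘(ℝ, E) _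
    ⟨ha'.sourcePartialDiffeomorph (normalizedOn_normalizedOpens a), ha.2.1, fun _ _ => rfl⟩
  refine h.congr_of_eventuallyEq ?_
  filter_upwards [ha.eventually] with g' hg'
  exact hg'.links.sourceMap_eq.symm

theorem ι_mem (f : SmoothCc 𝕜 E M) : A.ι f ∈ A.invariantWeaklyGrouplike := by
  obtain ⟨g, h⟩ := isInvariantPair_ι (A := A) f
  exact mem_invariantWeaklyGrouplike.2 ⟨_, h⟩

theorem normalizedAt_ι {f : SmoothCc 𝕜 E M} (hf : GermOne f y) : A.NormalizedAt (A.ι f) y := by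
  rwa [NormalizedAt, A.counit_ι]

variable (A) in
/-- The unit arrow at a point. -/
def unit (y : M) : A.Gsp :=
  ofElement (ι_mem (exists_germOne (𝕜 := 𝕜) (E := E) (x := y) univ_mem).choose)
    (normalizedAt_ι (exists_germOne (𝕜 := 𝕜) (E := E) (x := y) univ_mem).choose_spec.1)

theorem isRepresentedBy_unit {f : SmoothCc 𝕜 E M} (hf : GermOne f y) :
    (unit A y).IsRepresentedBy (A.ι f) :=
  (isRepresentedBy_ofElement _ _).congr (ι_mem f)
    (germ_ι_eq (exists_germOne (𝕜 := 𝕜) (E := E) (x := y) univ_mem).choose_spec.1 hf)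

theorem source_unit (y : M) : (unit A y).source = y := by
  obtain ⟨f, hf, -⟩ := exists_germOne (𝕜 := 𝕜) (E := E) (x := y) univ_mem
  exact (isRepresentedBy_unit (A := A) hf).links.source_unique (links_ι hf.eq_one)

theorem continuous_unit : Continuous (unit A) := by
  refine continuous_iff_continuousAt.2 fun y => ?_
  obtain ⟨f, hf, -⟩ := exists_germOne (𝕜 := 𝕜) (E := E) (x := y) univ_mem
  refine continuousAt_of_eventually (a := A.ι f) continuousAt_id ?_
  filter_upwards [eventually_eventually_nhds.2 hf] with z hz
  exact isRepresentedBy_unit hz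

theorem antipode_mem (ha : a ∈ A.invariantWeaklyGrouplike) :
    A.antipode a ∈ A.invariantWeaklyGrouplike := by
  obtain ⟨a', h⟩ := mem_invariantWeaklyGrouplike.1 ha
  exact mem_invariantWeaklyGrouplike.2 ⟨_, h.antipode⟩

theorem IsRepresentedBy.normalizedAt_antipode {g : A.Gsp} (ha : g.IsRepresentedBy a) :
    A.NormalizedAt (A.antipode a) g.source := by
  obtain ⟨a', h⟩ := mem_invariantWeaklyGrouplike.1 ha.1
  exact ha.links.normalizedAt_antipode h ha.2.1

/-- The inverse of an arrow. -/
def inv (g : A.Gsp) : A.Gsp :=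
  ofElement (antipode_mem g.exists_isRepresentedBy.choose_spec.1)
    g.exists_isRepresentedBy.choose_spec.normalizedAt_antipode

theorem IsRepresentedBy.inv {g : A.Gsp} (ha : g.IsRepresentedBy a) :
    g.inv.IsRepresentedBy (A.antipode a) := by
  have h := g.exists_isRepresentedBy.choose_spec
  obtain ⟨a', ha'⟩ := mem_invariantWeaklyGrouplike.1 ha.1
  obtain ⟨c', hc'⟩ := mem_invariantWeaklyGrouplike.1 h.1
  exact (isRepresentedBy_ofElement (antipode_mem h.1) h.normalizedAt_antipode).congr
    (antipode_mem ha.1) (h.links.germ_antipode_congr hc' h.2.1 ha' (h.germ_eq ha))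

theorem source_inv (g : A.Gsp) : g.inv.source = g.target := by
  obtain ⟨a, ha⟩ := g.exists_isRepresentedBy
  obtain ⟨a', ha'⟩ := mem_invariantWeaklyGrouplike.1 ha.1
  exact ha.inv.links.source_unique (ha.links.antipode ha')

theorem continuous_inv : Continuous (inv : A.Gsp → A.Gsp) := by
  refine continuous_iff_continuousAt.2 fun g => ?_
  obtain ⟨a, ha⟩ := g.exists_isRepresentedBy
  refine continuousAt_of_eventually (a := A.antipode a)
    isLocalDiffeomorph_source.contMDiff.continuous.continuousAt ?_
  exact ha.eventually.mono fun g' hg' => hg'.inv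

theorem mul_mem (hb : b ∈ A.invariantWeaklyGrouplike) (ha : a ∈ A.invariantWeaklyGrouplike) :
    b * a ∈ A.invariantWeaklyGrouplike := by
  obtain ⟨a', ha⟩ := mem_invariantWeaklyGrouplike.1 ha
  obtain ⟨b', hb⟩ := mem_invariantWeaklyGrouplike.1 hb
  exact mem_invariantWeaklyGrouplike.2 ⟨_, ha.mul hb⟩

theorem IsRepresentedBy.links' {h : A.Gsp} (hb : h.IsRepresentedBy b) (hy : h.source = y) :
    A.Links b y h.target :=
  hy ▸ hb.links

theorem IsRepresentedBy.normalizedAt_mul {h g : A.Gsp} (hb : h.IsRepresentedBy b)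
    (ha : g.IsRepresentedBy a) (hhg : h.source = g.target) :
    A.NormalizedAt (b * a) h.target := by
  obtain ⟨a', ha'⟩ := mem_invariantWeaklyGrouplike.1 ha.1
  obtain ⟨b', hb'⟩ := mem_invariantWeaklyGrouplike.1 hb.1
  exact (hb.links' hhg).normalizedAt_mul hb' ha' hb.2.1 ha.2.1

/-- The product of composable arrows. -/
def mul (p : {p : A.Gsp × A.Gsp // p.1.source = p.2.target}) : A.Gsp :=
  ofElement (mul_mem p.1.1.exists_isRepresentedBy.choose_spec.1
      p.1.2.exists_isRepresentedBy.choose_spec.1)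
    (p.1.1.exists_isRepresentedBy.choose_spec.normalizedAt_mul
      p.1.2.exists_isRepresentedBy.choose_spec p.2)

theorem IsRepresentedBy.mul {p : {p : A.Gsp × A.Gsp // p.1.source = p.2.target}}
    (hb : p.1.1.IsRepresentedBy b) (ha : p.1.2.IsRepresentedBy a) :
    (mul p).IsRepresentedBy (b * a) := by
  have h₁ := p.1.1.exists_isRepresentedBy.choose_spec
  have h₂ := p.1.2.exists_isRepresentedBy.choose_spec
  obtain ⟨c', hc'⟩ := mem_invariantWeaklyGrouplike.1 h₁.1
  refine (isRepresentedBy_ofElement (mul_mem h₁.1 h₂.1) (h₁.normalizedAt_mul h₂ p.2)).congr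
    (mul_mem hb.1 ha.1) ?_
  change A.germ p.1.1.target _ = A.germ p.1.1.target _
  rw [(h₁.links' p.2).germ_mul_congr_right hc' h₁.2.1 (h₂.germ_eq ha)]
  exact germ_mul_congr_left (h₁.germ_eq hb) a

theorem source_mul (p : {p : A.Gsp × A.Gsp // p.1.source = p.2.target}) :
    (mul p).source = p.1.2.source := by
  obtain ⟨b, hb⟩ := p.1.1.exists_isRepresentedBy
  obtain ⟨a, ha⟩ := p.1.2.exists_isRepresentedBy
  obtain ⟨a', ha'⟩ := mem_invariantWeaklyGrouplike.1 ha.1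
  obtain ⟨b', hb'⟩ := mem_invariantWeaklyGrouplike.1 hb.1
  exact (hb.mul ha).links.source_unique ((hb.links' p.2).mul ha.links hb' ha')

theorem continuous_mul :
    Continuous (mul : {p : A.Gsp × A.Gsp // p.1.source = p.2.target} → A.Gsp) := by
  refine continuous_iff_continuousAt.2 fun p => ?_
  obtain ⟨b, hb⟩ := p.1.1.exists_isRepresentedBy
  obtain ⟨a, ha⟩ := p.1.2.exists_isRepresentedBy
  have h₁ : Continuous fun q : {p : A.Gsp × A.Gsp // p.1.source = p.2.target} => q.1.1 :=
    continuous_fst.comp continuous_subtype_val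
  have h₂ : Continuous fun q : {p : A.Gsp × A.Gsp // p.1.source = p.2.target} => q.1.2 :=
    continuous_snd.comp continuous_subtype_val
  refine continuousAt_of_eventually (a := b * a) (continuous_target.comp h₁).continuousAt ?_
  filter_upwards [h₁.continuousAt.eventually hb.eventually,
    h₂.continuousAt.eventually ha.eventually] with q hq₁ hq₂
  exact hq₁.mul hq₂

variable (A) in
/-- The étale Lie groupoid of arrows of a Hopf algebroid. -/
def spectralGroupoid : EtaleLieGroupoid E M A.Gsp where
  source := source
  target := target
  unit := unit A
  inv := inv
  mul := mul
  source_unit := source_unit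
  target_unit _ := rfl
  source_inv := source_inv
  target_inv _ := rfl
  source_mul := source_mul
  target_mul _ := rfl
  mul_assoc g h k hgh hhk := by
    obtain ⟨a, ha⟩ := g.exists_isRepresentedBy
    obtain ⟨b, hb⟩ := h.exists_isRepresentedBy
    obtain ⟨c, hc⟩ := k.exists_isRepresentedBy
    refine ext_of_isRepresentedBy (a := a * (b * c)) rfl ?_ ?_
    · rw [← mul_assoc]
      exact IsRepresentedBy.mul (IsRepresentedBy.mul ha hb) hc
    · exact IsRepresentedBy.mul ha (IsRepresentedBy.mul hb hc)
  unit_mul g := by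
    obtain ⟨a, ha⟩ := g.exists_isRepresentedBy
    obtain ⟨f, hf, -⟩ := exists_germOne (𝕜 := 𝕜) (E := E) (x := g.target) univ_mem
    exact ext_of_germ_eq rfl (IsRepresentedBy.mul (isRepresentedBy_unit hf) ha) ha
      (germ_ι_mul hf a)
  mul_unit g := by
    obtain ⟨a, ha⟩ := g.exists_isRepresentedBy
    obtain ⟨a', ha'⟩ := mem_invariantWeaklyGrouplike.1 ha.1
    obtain ⟨f, hf, -⟩ := exists_germOne (𝕜 := 𝕜) (E := E) (x := g.source) univ_mem
    exact ext_of_germ_eq rfl (IsRepresentedBy.mul ha (isRepresentedBy_unit hf)) ha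
      (ha.links.germ_mul_ι ha' ha.2.1 hf)
  inv_mul g := by
    obtain ⟨a, ha⟩ := g.exists_isRepresentedBy
    obtain ⟨a', ha'⟩ := mem_invariantWeaklyGrouplike.1 ha.1
    have hn := ha.normalizedAt_antipode
    -- This reads `S(a) a = ε(S a)²`, a function equal to `1` near the source, hence a
    -- representative of the unit there.
    have h := ha'.antipode.mul_antipode_eq
    rw [A.antipode_antipode, ← map_mul] at h
    refine ext_of_isRepresentedBy rfl (IsRepresentedBy.mul ha.inv ha) ?_
    rw [h]
    exact isRepresentedBy_unit (GermOne.mul hn hn)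
  mul_inv g := by
    obtain ⟨a, ha⟩ := g.exists_isRepresentedBy
    obtain ⟨a', ha'⟩ := mem_invariantWeaklyGrouplike.1 ha.1
    have h := ha'.mul_antipode_eq
    rw [← map_mul] at h
    refine ext_of_isRepresentedBy rfl (IsRepresentedBy.mul ha ha.inv) ?_
    rw [h]
    exact isRepresentedBy_unit (GermOne.mul ha.2.1 ha.2.1)
  source_localDiffeo := isLocalDiffeomorph_source
  target_localDiffeo := isLocalDiffeomorph_target
  unit_localDiffeo := isLocalDiffeomorph_target.of_comp_left continuous_unit isLocalDiffeomorph_id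
  inv_localDiffeo := isLocalDiffeomorph_target.of_comp_left continuous_inv
    isLocalDiffeomorph_source
  mul_localDiffeo := by
    -- The space of composable pairs gets its smooth structure from the first projection. The second
    -- projection lifts `source ∘ fst` along the target, by composability, and multiplication lifts
    -- `target ∘ fst`.
    have hfst := IsLocalHomeomorph.fst_fibredProduct
      (isLocalDiffeomorph_source (A := A)).contMDiff.continuous
      (isLocalHomeomorph_target (A := A))
    let := hfst.pullbackChartedSpace (E := E)
    have h₁ := hfst.pullback_isLocalDiffeomorph (E := E)
    refine ⟨this, hfst.pullback_isManifold, h₁, ?_, ?_⟩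
    · refine isLocalDiffeomorph_target.of_comp_left
        (continuous_snd.comp continuous_subtype_val) ?_
      have h₂ := isLocalDiffeomorph_source.comp_fun h₁
      convert h₂ using 2 with q
      exact q.2.symm
    · have h₂ := isLocalDiffeomorph_target.comp_fun h₁
      exact isLocalDiffeomorph_target.of_comp_left continuous_mul h₂

theorem isSpectralGroupoid : A.IsSpectralGroupoid (spectralGroupoid A) where
  target_eq _ := rfl
  source_eq g a ha W V τ hW hτ hg := by
    obtain ⟨a', ha'⟩ := mem_invariantWeaklyGrouplike.1 ha.1
    have h := hτ.links ha' hW (τ.symm ⟨g.1.proj, hg⟩)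
    rw [τ.apply_symm_apply] at h
    exact ha.links.source_unique h
  unit_eq _ _ hf := isRepresentedBy_unit hf
  mul_eq _ _ _ _ _ hb ha := IsRepresentedBy.mul hb ha
  inv_eq _ _ ha := ha.inv

/-! ### Functoriality -/

variable {B : HopfAlgebroid.{v} 𝕜 (SmoothCc 𝕜 E M)}

theorem IsRepresentedBy.map {g : A.Gsp} (ha : g.IsRepresentedBy a) (α : A ⟶ B) :
    (map α g).IsRepresentedBy (Hom.toAlgHom α a) := by
  refine ⟨Hom.map_invariantWeaklyGrouplike α ha.1, ?_, ?_⟩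
  · rw [NormalizedAt, Hom.counit_map]
    exact ha.2.1
  · change stalkMap α g.1.proj g.1.val = _
    rw [ha.2.2]
    rfl

/-- In the form `T_{S a} g = ε(a g)`, the link condition involves only products with functions and
the counit, both preserved by `α`. -/
theorem _root_.HopfAlgebroid.Links.map (h : A.Links a x y) (α : A ⟶ B) :
    B.Links (Hom.toAlgHom α a) x y := by
  refine ⟨by rw [Hom.counit_map, h.counit_eq], fun g => ?_⟩
  rw [T_antipode_apply, ← Hom.map_ι α, ← map_mul, Hom.counit_map, ← T_antipode_apply,
    h.T_antipode_eq]

theorem continuous_map (α : A ⟶ B) : Continuous (map α) := by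
  refine continuous_iff_continuousAt.2 fun g => ?_
  obtain ⟨a, ha⟩ := g.exists_isRepresentedBy
  exact continuousAt_of_eventually (a := Hom.toAlgHom α a) continuous_target.continuousAt
    (ha.eventually.mono fun h hh => hh.map α)

theorem isMorphism_map (α : A ⟶ B) :
    (spectralGroupoid A).IsMorphism (spectralGroupoid B) (map α) where
  smooth := (isLocalDiffeomorph_target.of_comp_left (continuous_map α)
    isLocalDiffeomorph_target).contMDiff
  map_unit y := by
    obtain ⟨f, hf, -⟩ := exists_germOne (𝕜 := 𝕜) (E := E) (x := y) univ_mem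
    refine ext_of_isRepresentedBy rfl ((isRepresentedBy_unit hf).map α) ?_
    rw [Hom.map_ι]
    exact isRepresentedBy_unit hf
  source_map g := by
    obtain ⟨a, ha⟩ := g.exists_isRepresentedBy
    exact (ha.map α).links.source_unique (ha.links.map α)
  target_map _ := rfl
  map_mul g h hgh := by
    obtain ⟨b, hb⟩ := g.exists_isRepresentedBy
    obtain ⟨a, ha⟩ := h.exists_isRepresentedBy
    refine ext_of_isRepresentedBy rfl ((IsRepresentedBy.mul hb ha).map α) ?_
    rw [_root_.map_mul]
    exact IsRepresentedBy.mul (hb.map α) (ha.map α)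

theorem map_id (g : A.Gsp) : map (𝟙 A) g = g := by
  obtain ⟨a, ha⟩ := g.exists_isRepresentedBy
  exact ext_of_isRepresentedBy rfl (ha.map (𝟙 A)) ha

theorem map_comp {C : HopfAlgebroid.{v} 𝕜 (SmoothCc 𝕜 E M)} (α : A ⟶ B) (β : B ⟶ C)
    (g : A.Gsp) : map (α ≫ β) g = map β (map α g) := by
  obtain ⟨a, ha⟩ := g.exists_isRepresentedBy
  exact ext_of_isRepresentedBy rfl (ha.map (α ≫ β)) ((ha.map α).map β)

variable (𝕜 E M) in
/-- The functor which assigns to a Hopf algebroid its étale Lie groupoid of arrows. -/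
def spectralFunctor : HopfAlgebroid.{v} 𝕜 (SmoothCc 𝕜 E M) ⥤ EtGrpd.{max u v} E M where
  obj A := { Arr := A.Gsp, groupoid := spectralGroupoid A }
  map α := ⟨map α, isMorphism_map α⟩
  map_id _ := Subtype.ext (funext map_id)
  map_comp α β := Subtype.ext (funext (map_comp α β))

end Gsp

end Arrows

end HopfAlgebroid

end

theorem theorem24 {𝕜 : Type*} [RCLike 𝕜] {E : Type*} [NormedAddCommGroup E] [NormedSpace ℝ E]
    [FiniteDimensional ℝ E] {M : Type u} [TopologicalSpace M] [T2Space M] [ChartedSpace E M]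
    [IsManifold 𝓘(ℝ, E) ∞ M] :
    -- the diffeomorphisms `τ_{W,a}` exist and are unique
    (∀ (A : HopfAlgebroid.{v} 𝕜 (SmoothCc 𝕜 E M)), ∀ a ∈ A.invariantWeaklyGrouplike,
      ∀ W : Opens M, A.NormalizedOn a W →
        ∃! p : (V : Opens M) × Diffeomorph 𝓘(ℝ, E) 𝓘(ℝ, E) V W ∞, A.IsInduced a W p.1 p.2) ∧
    -- the arrows form a subsheaf of the spectral sheaf, with the basis of the sets `a_W`
    (∀ (A : HopfAlgebroid.{v} 𝕜 (SmoothCc 𝕜 E M)),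
      IsOpen A.arrows ∧
      IsTopologicalBasis {s : Set A.Gsp | ∃ a ∈ A.invariantWeaklyGrouplike, ∃ W : Opens M,
        A.NormalizedOn a W ∧ s = Subtype.val ⁻¹' A.basicSet a W} ∧
      ∀ a ∈ A.invariantWeaklyGrouplike, ∀ y : M, A.NormalizedAt a y →
        ∃ g : A.Gsp, g.1.proj = y ∧ g.IsRepresentedBy a) ∧
    -- the sheaf of arrows is an étale Lie groupoid, functorially in the Hopf algebroid
    ∃ 𝒢 : ∀ A : HopfAlgebroid.{v} 𝕜 (SmoothCc 𝕜 E M), EtaleLieGroupoid E M A.Gsp,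
      (∀ A : HopfAlgebroid.{v} 𝕜 (SmoothCc 𝕜 E M), A.IsSpectralGroupoid (𝒢 A)) ∧
      ∃ hmap : ∀ {A B : HopfAlgebroid.{v} 𝕜 (SmoothCc 𝕜 E M)} (α : A ⟶ B),
          (𝒢 A).IsMorphism (𝒢 B) (HopfAlgebroid.Gsp.map α),
        ∃ F : HopfAlgebroid.{v} 𝕜 (SmoothCc 𝕜 E M) ⥤ EtGrpd.{max u v} E M,
          F.toPrefunctor =
            { obj := fun A => { Arr := A.Gsp, groupoid := 𝒢 A }
              map := fun α => ⟨HopfAlgebroid.Gsp.map α, hmap α⟩ } := by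
  exact ⟨fun A a ha W hW => HopfAlgebroid.existsUnique_isInduced ha hW,
    fun A => ⟨HopfAlgebroid.isOpen_arrows, HopfAlgebroid.isTopologicalBasis_basicSet,
      fun a ha y hn => ⟨.ofElement ha hn, rfl,
        HopfAlgebroid.Gsp.isRepresentedBy_ofElement ha hn⟩⟩,
    HopfAlgebroid.Gsp.spectralGroupoid, fun A => HopfAlgebroid.Gsp.isSpectralGroupoid,
    HopfAlgebroid.Gsp.isMorphism_map, HopfAlgebroid.Gsp.spectralFunctor 𝕜 E M, rfl⟩
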